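/- **Setting.** Let $V,\lambda,T>0$, $\mathbb T=\mathbb R/\mathbb Z$, $\Omega_V=\mathbb T\times\{-V,V\}$, $\iota(x,v)=(x,-v)$, and let $\pi=\mathcal L_{\mathbb T}\otimes\mathrm{Unif}_{\{-V,V\}}$ be the uniform probability measure on $\Omega_V$. Write $C^{1,0}(\Omega_V)$ for the functions $\varphi(x,v)$ that are $C^1$ in $x$, and $\langle\varphi,j\rangle=\int\varphi_1\,dj^1+\int\varphi_2\,dj^2$ for $\varphi=(\varphi_1,\varphi_2)$ and $j=(j^1,j^2)\in\mathcal M(\Omega_V;\mathbb R^2)$, a pair of finite signed Borel measures. *Continuity equation.* $(\sigma,j)\in\mathrm{CE}(0,T;\Omega_V)$ means: $\sigma\in C([0,T];\mathcal P(\Omega_V))$ for the narrow topology; $(j_t)_{t\in(0,T)}\subset\mathcal M(\Omega_V;\mathbb R^2)$ is a measurable family with $\int_0^T\|j_t\|_{\mathrm{TV}}\,dt<\infty$; and for all $\varphi\in C^{1,0}(\Omega_V)$ and $0\le s\le t\le T$, $$\int\varphi\,d\sigma_t-\int\varphi\,d\sigma_s=\int_s^t\big\langle(\partial_x\varphi,\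 \varphi\circ\iota-\varphi),\,j_r\big\rangle\,dr .$$ *Functionals.* For finite measures $\mu,\nu$ put $\mathrm{Ent}(\mu|\nu)=\int(f\log f-f+1)\,d\nu$ if $\mu\ll\nu$ with $f=\frac{d\mu}{d\nu}$, and $+\infty$ otherwise. For $\eta\in\mathcal P(\Omega_V)$ put $$\mathrm{FI}(\eta|\pi)=\frac12\int_{\Omega_V}\Big(\sqrt{\tfrac{d\eta}{d\pi}\circ\iota}-\sqrt{\tfrac{d\eta}{d\pi}}\Big)^2d\pi\ \text{ if }\eta\ll\pi,\qquad \mathrm{FI}(\eta|\pi)=+\infty\text{ otherwise.}$$ Put $$\mathscr L(\sigma,j)=\sup_{\varphi\in C(\Omega_V;\mathbb R^2)}\Big\{\langle\varphi,j\rangle-\int_{\Omega_V}\big[v\,\varphi_1+\lambda(e^{\varphi_2}-1)\big]\,d\sigma\Big\},$$ and $\mathscr I(\sigma,j)=\int_0^T\mathscr L(\sigma_t,j_t)\,dt$ if $(\sigma,j)\in\mathrm{CE}(0,T;\Omega_V)$, $\mathscr I(\sigma,j)=+\infty$ otherwise. **Theorem 3.1.** Let $(\sigma,j)\in\mathrm{CE}(0,T;\Omega_V)$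 satisfy $\mathrm{Ent}(\sigma_0|\pi)+\mathscr I(\sigma,j)<\infty$. Then for every $t\in[0,T]$, $$\frac12\,\mathrm{Ent}(\sigma_t|\pi)+\lambda\int_0^t\mathrm{FI}(\sigma_r|\pi)\,dr\ \le\ \frac12\,\mathrm{Ent}(\sigma_0|\pi)+\mathscr I(\sigma,j).$$ In particular the relative entropy is a Lyapunov function for the Kac equation $\partial_t\sigma+v\,\partial_x\sigma=\lambda(\iota_\sharp\sigma-\sigma)$: the map $t\mapsto\mathrm{Ent}(\sigma_t|\pi)\in[0,\infty]$ is non-increasing on $[0,T]$ whenever $\sigma$ is - a weak solution with some initial datum $\bar\sigma\in\mathcal P(\Omega_V)$, i.e. $\sigma\in C([0,T];\mathcal P(\Omega_V))$, $\sigma|_{t=0}=\bar\sigma$, and $\int\varphi\,d\sigma_t-\int\varphi\,d\sigma_s=\int_s^t\int_{\Omega_V}\big[v\,\partial_x\varphi+\lambda(\varphi\circ\iota-\varphi)\big]d\sigma_r\,dr$ for all $\varphi\in C^{1,0}(\Omega_V)$ and $0\le s\le t\le T$; or - a variational solution with some initial datum $\bar\sigma\in\mathcal P(\Omega_V)$,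 i.e. there is $j$ with $(\sigma,j)\in\mathrm{CE}(0,T;\Omega_V)$ and $\mathrm{Ent}(\sigma|_{t=0}\,|\,\bar\sigma)+\mathscr I(\sigma,j)=0$. -/

import Mathlib

open MeasureTheory Set
open scoped ENNReal

noncomputable section

namespace Kac

/-- The velocity set `{-V, V}`. -/
abbrev Vel (V : ℝ) : Type := ({-V, V} : Set ℝ)

/-- The state space `Ω_V = 𝕋 × {-V, V}`, with `𝕋 = ℝ / ℤ`. -/
abbrev Omega (V : ℝ) : Type := UnitAddCircle × Vel V

variable {V : ℝ}

/-- The velocity `V`. -/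
def velPos (V : ℝ) : Vel V := ⟨V, Or.inr rfl⟩

/-- The velocity `-V`. -/
def velNeg (V : ℝ) : Vel V := ⟨-V, Or.inl rfl⟩

/-- Reversal of a velocity. -/
def Vel.flip (v : Vel V) : Vel V :=
  ⟨-v.1, by
    rcases v.2 with h | h
    · right
      show -v.1 = V
      rw [h, neg_neg]
    · left
      show -v.1 = -V
      rw [h]⟩

/-- The velocity-reversal map `ι (x, v) = (x, -v)`. -/
def iota (z : Omega V) : Omega V := (z.1, z.2.flip)

/-- The uniform distribution `π = 𝓛_𝕋 ⊗ Unif {-V, V}` on `Ω_V`. -/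
def stat (V : ℝ) : Measure (Omega V) :=
  (volume : Measure UnitAddCircle).prod
    ((2⁻¹ : ℝ≥0∞) • (Measure.dirac (velPos V) + Measure.dirac (velNeg V)))

/-- The class `C^{1,0}(Ω_V)`: for each velocity, `φ` is continuously differentiable in `x`, i.e. its
periodic lift to `ℝ` is. -/
def IsC10 (φ : Omega V → ℝ) : Prop :=
  ∀ v : Vel V, ContDiff ℝ 1 fun y : ℝ => φ ((y : UnitAddCircle), v)

/-- The spatial derivative `∂ₓ φ`. -/
def dx (φ : Omega V → ℝ) (z : Omega V) : ℝ :=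
  deriv (fun s : ℝ => φ (z.1 + (s : UnitAddCircle), z.2)) 0

/-- The discrete velocity derivative `φ ∘ ι - φ`. -/
def dv (φ : Omega V → ℝ) (z : Omega V) : ℝ := φ (iota z) - φ z

/-- Elements `j = (j¹, j²)` of `𝓜(Ω_V; ℝ²)`: pairs of finite signed Borel measures. -/
abbrev Flux (V : ℝ) : Type := SignedMeasure (Omega V) × SignedMeasure (Omega V)

/-- The pairing `⟨φ, j⟩ = ∫ φ₁ dj¹ + ∫ φ₂ dj²`. -/
def pairing (φ₁ φ₂ : Omega V → ℝ) (j : Flux V) : ℝ :=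
  j.1.integral φ₁ (ContinuousLinearMap.lsmul ℝ ℝ).flip +
    j.2.integral φ₂ (ContinuousLinearMap.lsmul ℝ ℝ).flip

/-- The total variation norm on `𝓜(Ω_V; ℝ²)`; test functions are bounded componentwise by `1`,
so it is the sum of the total variations of the components. -/
def tvNorm (j : Flux V) : ℝ≥0∞ := j.1.variation univ + j.2.variation univ

/-- `(σ, j) ∈ CE(0, T; Ω_V)`. Only the values of `σ` on `[0, T]` and of `j` on `(0, T)` matter.
The topology on `ProbabilityMeasure` is the narrow one. -/
structure CE (T : ℝ) (σ : ℝ → ProbabilityMeasure (Omega V)) (j : ℝ → Flux V) : Prop where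
  continuousOn : ContinuousOn σ (Icc 0 T)
  measurable_fst : ∀ B : Set (Omega V), MeasurableSet B →
    Measurable fun t : Ioo (0 : ℝ) T => (j t).1 B
  measurable_snd : ∀ B : Set (Omega V), MeasurableSet B →
    Measurable fun t : Ioo (0 : ℝ) T => (j t).2 B
  tvNorm_lt_top : ∫⁻ t in Ioo 0 T, tvNorm (j t) < ∞
  weak : ∀ φ : Omega V → ℝ, IsC10 φ → ∀ s t : ℝ, 0 ≤ s → s ≤ t → t ≤ T →
    (∫ z, φ z ∂(σ t : Measure (Omega V))) - ∫ z, φ z ∂(σ s : Measure (Omega V))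
      = ∫ r in s..t, pairing (dx φ) (dv φ) (j r)

/-- The Hamiltonian `𝓗(σ, φ) = ∫ [v φ₁ + λ (exp φ₂ - 1)] dσ`. -/
def hamiltonian (lam : ℝ) (σ : ProbabilityMeasure (Omega V)) (φ₁ φ₂ : Omega V → ℝ) : ℝ :=
  ∫ z, ((z.2 : ℝ) * φ₁ z + lam * (Real.exp (φ₂ z) - 1)) ∂(σ : Measure (Omega V))

/-- The Lagrangian: the Legendre dual
`𝓛(σ, j) = sup { ⟨φ, j⟩ - 𝓗(σ, φ) : φ ∈ C(Ω_V; ℝ²) }`, an element of `[0, ∞]`. The value at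
`φ = 0` is `0`, so truncating the competitors at `0` does not change the supremum. -/
def lagrangian (lam : ℝ) (σ : ProbabilityMeasure (Omega V)) (j : Flux V) : ℝ≥0∞ :=
  ⨆ (φ₁ : C(Omega V, ℝ)) (φ₂ : C(Omega V, ℝ)),
    ENNReal.ofReal (pairing φ₁ φ₂ j - hamiltonian lam σ φ₁ φ₂)

open Classical in
/-- The rate functional `𝓘(σ, j)`: the time integral of the Lagrangian on `CE(0, T; Ω_V)`, and `∞`
elsewhere. -/
def rate (lam T : ℝ) (σ : ℝ → ProbabilityMeasure (Omega V)) (j : ℝ → Flux V) : ℝ≥0∞ :=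
  if CE T σ j then ∫⁻ t in Ioo 0 T, lagrangian lam (σ t) (j t) else ∞

/-- The relative entropy `Ent(μ | ν)` of finite measures: `∫ (f log f - f + 1) dν` if `μ ≪ ν` with
`f = dμ/dν`, and `∞` otherwise. This is Mathlib's Kullback-Leibler divergence. -/
def Ent (μ ν : Measure (Omega V)) : ℝ≥0∞ := InformationTheory.klDiv μ ν

/-- The displayed formula for the relative entropy. -/
theorem ent_eq (μ ν : Measure (Omega V)) [IsFiniteMeasure μ] [IsFiniteMeasure ν] (h : μ ≪ ν) :
    Ent μ ν = ∫⁻ z, ENNReal.ofReal ((μ.rnDeriv ν z).toReal * Real.log (μ.rnDeriv ν z).toReal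
      - (μ.rnDeriv ν z).toReal + 1) ∂ν := by
  rw [Ent, InformationTheory.klDiv_eq_lintegral_klFun_of_ac h]
  refine lintegral_congr fun z => ?_
  rw [InformationTheory.klFun]
  congr 1
  ring

theorem ent_of_not_ac (μ ν : Measure (Omega V)) (h : ¬ μ ≪ ν) : Ent μ ν = ∞ :=
  InformationTheory.klDiv_of_not_ac h

open Classical in
/-- The Fisher information `FI(η | π) = ½ ∫ (√(f ∘ ι) - √f)² dπ` if `η ≪ π` with `f = dη/dπ`, and
`∞` otherwise. -/
def FI (η : ProbabilityMeasure (Omega V)) : ℝ≥0∞ :=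
  if (η : Measure (Omega V)) ≪ stat V then
    2⁻¹ * ∫⁻ z, ENNReal.ofReal
      ((√((η : Measure (Omega V)).rnDeriv (stat V) (iota z)).toReal
        - √((η : Measure (Omega V)).rnDeriv (stat V) z).toReal) ^ 2) ∂(stat V)
  else ∞

/-- The generator `Q φ = v ∂ₓ φ + λ (φ ∘ ι - φ)` of the Kac process. -/
def generator (lam : ℝ) (φ : Omega V → ℝ) (z : Omega V) : ℝ :=
  (z.2 : ℝ) * dx φ z + lam * (φ (iota z) - φ z)

/-- Weak solutions on `[0, T]` of the Kac equation `∂ₜσ + v ∂ₓσ = λ (ι_♯ σ - σ)` with initial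
datum `σ₀`. -/
structure IsWeakSolution (lam T : ℝ) (σ₀ : ProbabilityMeasure (Omega V))
    (σ : ℝ → ProbabilityMeasure (Omega V)) : Prop where
  continuousOn : ContinuousOn σ (Icc 0 T)
  initial : σ 0 = σ₀
  weak : ∀ φ : Omega V → ℝ, IsC10 φ → ∀ s t : ℝ, 0 ≤ s → s ≤ t → t ≤ T →
    (∫ z, φ z ∂(σ t : Measure (Omega V))) - ∫ z, φ z ∂(σ s : Measure (Omega V))
      = ∫ r in s..t, ∫ z, generator lam φ z ∂(σ r : Measure (Omega V))

/-- Variational solutions on `[0, T]` of the Kac equation with initial datum `σ₀`. -/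
def IsVariationalSolution (lam T : ℝ) (σ₀ : ProbabilityMeasure (Omega V))
    (σ : ℝ → ProbabilityMeasure (Omega V)) : Prop :=
  ∃ j : ℝ → Flux V, CE T σ j ∧
    Ent (σ 0 : Measure (Omega V)) (σ₀ : Measure (Omega V)) + rate lam T σ j = 0

end Kac

end

/-!
For a positive density `f = dσ/dπ` the natural test function is `φ = ½ log f`. Since `v log f ∂ₓ f`
is an `x`-derivative, the transport term vanishes in mean, and the Hamiltonian along `φ` is
`λ ∫ (√(f ∘ ι) √f - f) dπ = -λ FI(σ | π)`. As `⟨∇φ, j⟩ ≤ 𝓛(σ, j) + 𝓗(σ, ∇φ)` by definition of `𝓛`,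
the derivative `⟨∇φ, j⟩` of `½ Ent(σ | π)` is at most `𝓛(σ, j) - λ FI(σ | π)`.

To make this rigorous, a strictly positive Markov kernel (`Mollifier`) smooths `σ`. It commutes with
spatial translations and with `ι`, so by duality it can be put on the test functions, and Jensen's
inequality for `exp` shows that this does not increase the Hamiltonian
(`Mollifier.hamiltonian_smooth_le`). No chain rule in time is needed: convexity of the entropy
bounds half its increment over `[s, t]` by the increment of the integral of the fixed function
`½ log f_t` (`Mollifier.entropy_sub_le`), and uniform continuity in time lets the bounds over short
intervals sum up to `Mollifier.entropy_add_fisher_le`.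

The mollification is removed by duality. Both functionals are suprema over continuous `g`, of
`∫ g dσ - ∫ (exp g - 1) dπ` for the entropy and of `∫ (1 - exp (½ (g ∘ ι - g))) dσ` for the Fisher
information (`Ent_le_of_forall`, `FI_le_of_forall`), hence lower semicontinuous along the
mollification; mollification does not increase the initial entropy (`Mollifier.ofReal_entropy_le`).

The only property of the curve that enters is `HamiltonianBound`. It holds with the accumulated
Lagrangian as cost for solutions of the continuity equation, and without cost for weak solutions,
because `x ≤ exp x - 1`; this yields the monotonicity of the entropy on every subinterval.
-/

noncomputable section

namespace Kac

open Filter Topology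

variable {V : ℝ}

/-! ### Integration on the state space -/

theorem flip_flip (v : Vel V) : v.flip.flip = v := Subtype.ext (neg_neg v.1)

theorem iota_iota (z : Omega V) : iota (iota z) = z := Prod.ext rfl (flip_flip z.2)

@[fun_prop]
theorem continuous_iota : Continuous (iota (V := V)) := by
  have : Continuous (Vel.flip (V := V)) := continuous_of_discreteTopology
  unfold iota
  fun_prop

theorem vel_eq (v : Vel V) : v = velPos V ∨ v = velNeg V := by
  rcases v.2 with h | h
  · exact Or.inr (Subtype.ext h)
  · exact Or.inl (Subtype.ext h)

theorem flip_velPos : (velPos V).flip = velNeg V := rfl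

theorem flip_velNeg : (velNeg V).flip = velPos V := Subtype.ext (neg_neg V)

instance : IsProbabilityMeasure (volume : Measure UnitAddCircle) :=
  ⟨UnitAddCircle.measure_univ⟩

instance : IsProbabilityMeasure
    ((2⁻¹ : ℝ≥0∞) • (Measure.dirac (velPos V) + Measure.dirac (velNeg V))) := by
  constructor
  rw [Measure.smul_apply, Measure.add_apply, measure_univ, measure_univ, smul_eq_mul,
    one_add_one_eq_two, ENNReal.inv_mul_cancel two_ne_zero (by simp)]

instance : IsProbabilityMeasure (stat V) := by
  unfold stat; infer_instance

theorem _root_.Continuous.integrable_of_compact {X : Type*} [TopologicalSpace X] [CompactSpace X]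
    [MeasurableSpace X] [BorelSpace X] [SecondCountableTopologyEither X ℝ] {f : X → ℝ}
    (hf : Continuous f) (μ : Measure X) [IsFiniteMeasure μ] : Integrable f μ :=
  hf.integrable_of_hasCompactSupport (HasCompactSupport.of_compactSpace f)

theorem integral_stat {g : Omega V → ℝ} (hg : Continuous g) :
    ∫ z, g z ∂stat V = 2⁻¹ * ((∫ x, g (x, velPos V)) + ∫ x, g (x, velNeg V)) := by
  unfold stat
  rw [integral_prod _ (hg.integrable_of_compact _)]
  have h : ∀ x : UnitAddCircle, ∫ v, g (x, v) ∂((2⁻¹ : ℝ≥0∞) •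
      (Measure.dirac (velPos V) + Measure.dirac (velNeg V)))
      = 2⁻¹ * (g (x, velPos V) + g (x, velNeg V)) := fun x => by
    have hc : Continuous fun v : Vel V => g (x, v) := by fun_prop
    rw [integral_smul_measure, integral_add_measure (hc.integrable_of_compact _)
      (hc.integrable_of_compact _), integral_dirac, integral_dirac]
    simp
  simp_rw [h]
  rw [integral_const_mul, integral_add]
  · exact Continuous.integrable_of_compact (by fun_prop) _
  · exact Continuous.integrable_of_compact (by fun_prop) _

theorem measurePreserving_iota : MeasurePreserving (iota (V := V)) (stat V) (stat V) := by
  unfold stat iota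
  refine (MeasurePreserving.id _).prod ⟨measurable_of_finite _, ?_⟩
  have hm : Measurable (Vel.flip (V := V)) := measurable_of_finite _
  rw [Measure.map_smul, Measure.map_add _ _ hm, Measure.map_dirac' hm, Measure.map_dirac' hm,
    flip_velPos, flip_velNeg, add_comm]

theorem measurableEmbedding_iota : MeasurableEmbedding (iota (V := V)) :=
  (MeasurableEquiv.mk ⟨iota, iota, iota_iota, iota_iota⟩ continuous_iota.measurable
    continuous_iota.measurable).measurableEmbedding

theorem integral_comp_iota (g : Omega V → ℝ) :
    ∫ z, g (iota z) ∂stat V = ∫ z, g z ∂stat V :=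
  measurePreserving_iota.integral_comp measurableEmbedding_iota g

/-- Integrals of jointly continuous integrands against a narrowly continuous family of probability
measures depend continuously on the parameter. -/
theorem continuous_integral_of_continuous {X : Type*} [TopologicalSpace X]
    {σ : X → ProbabilityMeasure (Omega V)} (hσ : Continuous σ) {g : X → Omega V → ℝ}
    (hg : Continuous (Function.uncurry g)) :
    Continuous fun x => ∫ w, g x w ∂(σ x : Measure (Omega V)) := by
  rw [continuous_iff_continuousAt]
  intro x₀
  let G : C(X, C(Omega V, ℝ)) := ContinuousMap.curry ⟨Function.uncurry g, hg⟩
  have h1 : Tendsto (fun x => ∫ w, g x₀ w ∂(σ x : Measure (Omega V))) (𝓝 x₀)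
      (𝓝 (∫ w, g x₀ w ∂(σ x₀ : Measure (Omega V)))) :=
    ProbabilityMeasure.tendsto_iff_forall_integral_tendsto.1 (hσ.tendsto x₀)
      (BoundedContinuousFunction.mkOfCompact (G x₀))
  have h2 : Tendsto (fun x => ∫ w, (g x w - g x₀ w) ∂(σ x : Measure (Omega V))) (𝓝 x₀) (𝓝 0) := by
    have h3 : Tendsto (fun x => ‖G x - G x₀‖) (𝓝 x₀) (𝓝 0) := by
      have : Continuous fun x => ‖G x - G x₀‖ := by fun_prop
      simpa using this.tendsto x₀
    refine squeeze_zero_norm (fun x => ?_) h3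
    have := norm_integral_le_of_norm_le_const (μ := (σ x : Measure (Omega V)))
      (f := fun w => g x w - g x₀ w) (C := ‖G x - G x₀‖)
      (Eventually.of_forall fun w => (G x - G x₀).norm_coe_le_norm w)
    simpa using this
  have h4 := h1.add h2
  rw [add_zero] at h4
  refine h4.congr fun x => ?_
  have hc : ∀ x, Continuous (g x) := fun x => hg.comp (Continuous.prodMk_right x)
  rw [integral_sub ((hc x).integrable_of_compact _) ((hc x₀).integrable_of_compact _)]
  ring

theorem continuous_integral_stat {X : Type*} [TopologicalSpace X] {g : X → Omega V → ℝ}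
    (hg : Continuous (Function.uncurry g)) : Continuous fun x => ∫ w, g x w ∂stat V :=
  continuous_integral_of_continuous (σ := fun _ : X => ⟨stat V, inferInstance⟩)
    continuous_const hg

/-- The function `z ↦ ∫ κ(z, w) μ(dw)`. -/
def dens (κ : Omega V → Omega V → ℝ) (μ : Measure (Omega V)) (z : Omega V) : ℝ := ∫ w, κ z w ∂μ

/-- The function `w ↦ ∫ κ(z, w) g(z) π(dz)`: integration against it corresponds to integrating `g`
against the density `dens κ μ`. -/
def adj (κ : Omega V → Omega V → ℝ) (g : Omega V → ℝ) (w : Omega V) : ℝ :=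
  ∫ z, κ z w * g z ∂stat V

variable {κ : Omega V → Omega V → ℝ}

theorem continuous_dens_family (hκ : Continuous (Function.uncurry κ)) {X : Type*}
    [TopologicalSpace X] {σ : X → ProbabilityMeasure (Omega V)} (hσ : Continuous σ) :
    Continuous fun p : X × Omega V => dens κ (σ p.1 : Measure (Omega V)) p.2 := by
  unfold dens
  exact continuous_integral_of_continuous (σ := fun p : X × Omega V => σ p.1) (by fun_prop)
    (g := fun p w => κ p.2 w) (by fun_prop)

theorem continuous_dens (hκ : Continuous (Function.uncurry κ)) (μ : ProbabilityMeasure (Omega V)) :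
    Continuous (dens κ (μ : Measure (Omega V))) :=
  (continuous_dens_family hκ (σ := fun _ : Unit => μ) continuous_const).comp
    (Continuous.prodMk_right ())

theorem continuous_adj (hκ : Continuous (Function.uncurry κ)) {g : Omega V → ℝ}
    (hg : Continuous g) : Continuous (adj κ g) := by
  unfold adj
  exact continuous_integral_stat (g := fun w z => κ z w * g z) (by fun_prop)

theorem integral_mul_dens (hκ : Continuous (Function.uncurry κ)) {g : Omega V → ℝ}
    (hg : Continuous g) (μ : Measure (Omega V)) [IsFiniteMeasure μ] :
    ∫ z, g z * dens κ μ z ∂stat V = ∫ w, adj κ g w ∂μ := by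
  unfold dens adj
  simp_rw [← integral_const_mul]
  rw [integral_integral_swap_of_hasCompactSupport]
  · simp_rw [mul_comm]
  · fun_prop
  · exact HasCompactSupport.of_compactSpace _

theorem dx_of_hasDerivAt {φ : Omega V → ℝ} {x : ℝ} {v : Vel V} {d : ℝ}
    (h : HasDerivAt (fun y : ℝ => φ ((y : UnitAddCircle), v)) d x) :
    dx φ ((x : UnitAddCircle), v) = d := by
  unfold dx
  have h2 : HasDerivAt (fun s : ℝ => φ (((x + s : ℝ) : UnitAddCircle), v)) d 0 :=
    HasDerivAt.comp_const_add x 0 (by simpa using h)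
  rw [← h2.deriv]
  simp only [AddCircle.coe_add]

/-! ### Mollifiers -/

/-- A strictly positive smoothing kernel on `Ω_V`. It is Markov in both variables and commutes with
the velocity flip and with spatial translations; the last property enters through `der`, which is
the `x`-derivative in the first variable and minus the `x`-derivative in the second one. -/
structure Mollifier (V : ℝ) where
  ker : Omega V → Omega V → ℝ
  der : Omega V → Omega V → ℝ
  continuous_ker : Continuous (Function.uncurry ker)
  continuous_der : Continuous (Function.uncurry der)
  pos : ∀ z w, 0 < ker z w
  integral_left : ∀ w, ∫ z, ker z w ∂stat V = 1
  integral_right : ∀ z, ∫ w, ker z w ∂stat V = 1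
  ker_iota : ∀ z w, ker (iota z) (iota w) = ker z w
  hasDerivAt_left : ∀ (x : ℝ) (v : Vel V) (w : Omega V),
    HasDerivAt (fun y : ℝ => ker ((y : UnitAddCircle), v) w) (der ((x : UnitAddCircle), v) w) x
  hasDerivAt_right : ∀ (z : Omega V) (x : ℝ) (v : Vel V),
    HasDerivAt (fun y : ℝ => ker z ((y : UnitAddCircle), v)) (-der z ((x : UnitAddCircle), v)) x
  vel_mul_der : ∀ z w : Omega V, (w.2 : ℝ) * der z w = (z.2 : ℝ) * der z w

theorem continuous_vel : Continuous fun z : Omega V => (z.2 : ℝ) := by fun_prop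

theorem continuous_dv {φ : Omega V → ℝ} (hφ : Continuous φ) : Continuous (dv φ) := by
  unfold dv; fun_prop

/-- Differentiation under the integral sign along a circle variable. -/
theorem hasDerivAt_integral_circle {F D : UnitAddCircle → Omega V → ℝ}
    (hF : Continuous (Function.uncurry F)) (hD : Continuous (Function.uncurry D))
    (h : ∀ (x : ℝ) (w : Omega V),
      HasDerivAt (fun y : ℝ => F (y : UnitAddCircle) w) (D (x : UnitAddCircle) w) x)
    (μ : Measure (Omega V)) [IsFiniteMeasure μ] (x : ℝ) :
    HasDerivAt (fun y : ℝ => ∫ w, F (y : UnitAddCircle) w ∂μ) (∫ w, D (x : UnitAddCircle) w ∂μ)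
      x := by
  obtain ⟨C, hC⟩ := isCompact_univ.exists_bound_of_continuousOn hD.continuousOn
  have hFc : ∀ x : UnitAddCircle, Continuous (F x) := fun x => hF.comp (Continuous.prodMk_right x)
  have hDc : ∀ x : UnitAddCircle, Continuous (D x) := fun x => hD.comp (Continuous.prodMk_right x)
  exact (hasDerivAt_integral_of_dominated_loc_of_deriv_le (bound := fun _ => C) (s := univ)
    (F := fun (y : ℝ) w => F (y : UnitAddCircle) w)
    (F' := fun (y : ℝ) w => D (y : UnitAddCircle) w) univ_mem
    (Eventually.of_forall fun y => (hFc _).aestronglyMeasurable)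
    ((hFc _).integrable_of_compact μ) (hDc _).aestronglyMeasurable
    (Eventually.of_forall fun w y _ => hC ((y : UnitAddCircle), w) (mem_univ _))
    (integrable_const C) (Eventually.of_forall fun w y _ => h y w)).2

/-- The derivative of a function on the circle has mean zero. -/
theorem integral_circle_deriv {G D : UnitAddCircle → ℝ} (hD : Continuous D)
    (h : ∀ x : ℝ, HasDerivAt (fun y : ℝ => G (y : UnitAddCircle)) (D (x : UnitAddCircle)) x) :
    ∫ x, D x = 0 := by
  rw [← UnitAddCircle.intervalIntegral_preimage 0,
    intervalIntegral.integral_eq_sub_of_hasDerivAt (fun x _ => h x)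
      (Continuous.intervalIntegrable (by fun_prop) _ _)]
  simp [AddCircle.coe_period]

theorem exp_half_log {a : ℝ} (ha : 0 < a) : Real.exp (2⁻¹ * Real.log a) = √a := by
  rw [Real.sqrt_eq_rpow, Real.rpow_def_of_pos ha]
  ring_nf

namespace Mollifier

variable (K : Mollifier V)

theorem continuous_ker_left (w : Omega V) : Continuous fun z => K.ker z w :=
  K.continuous_ker.comp (Continuous.prodMk_left w)

theorem continuous_ker_right (z : Omega V) : Continuous (K.ker z) :=
  K.continuous_ker.comp (Continuous.prodMk_right z)

/-- The mollified density of `μ` with respect to `π`. -/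
abbrev density (μ : ProbabilityMeasure (Omega V)) : Omega V → ℝ :=
  dens K.ker (μ : Measure (Omega V))

/-- The mollification of a test function. -/
abbrev smooth (g : Omega V → ℝ) : Omega V → ℝ := adj K.ker g

theorem density_pos (μ : ProbabilityMeasure (Omega V)) (z : Omega V) : 0 < K.density μ z := by
  unfold density dens
  rw [integral_pos_iff_support_of_nonneg (fun w => (K.pos z w).le)
    ((K.continuous_ker_right z).integrable_of_compact _)]
  have : Function.support (K.ker z) = univ := eq_univ_of_forall fun w => (K.pos z w).ne'
  rw [this]
  simp

theorem smooth_const (c : ℝ) (w : Omega V) : K.smooth (fun _ => c) w = c := by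
  simp only [smooth, adj]
  rw [integral_mul_const, K.integral_left, one_mul]

theorem integrable_ker_mul {g : Omega V → ℝ} (hg : Continuous g) (w : Omega V) :
    Integrable (fun z => K.ker z w * g z) (stat V) :=
  Continuous.integrable_of_compact ((K.continuous_ker_left w).mul hg) _

theorem smooth_sub {g h : Omega V → ℝ} (hg : Continuous g) (hh : Continuous h) (w : Omega V) :
    K.smooth (fun z => g z - h z) w = K.smooth g w - K.smooth h w := by
  simp only [smooth, adj, mul_sub]
  exact integral_sub (K.integrable_ker_mul hg w) (K.integrable_ker_mul hh w)

theorem smooth_mono {g h : Omega V → ℝ} (hg : Continuous g) (hh : Continuous h)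
    (hgh : ∀ z, g z ≤ h z) (w : Omega V) : K.smooth g w ≤ K.smooth h w :=
  integral_mono (K.integrable_ker_mul hg w) (K.integrable_ker_mul hh w)
    fun z => mul_le_mul_of_nonneg_left (hgh z) (K.pos z w).le

theorem integral_density (μ : ProbabilityMeasure (Omega V)) :
    ∫ z, K.density μ z ∂stat V = 1 := by
  have h := integral_mul_dens K.continuous_ker (continuous_const (y := (1 : ℝ)))
    (μ : Measure (Omega V))
  simp only [one_mul] at h
  rw [h]
  change ∫ w, K.smooth (fun _ => 1) w ∂_ = 1
  simp_rw [K.smooth_const]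
  simp

/-- Mollification preserves integrals against the uniform distribution. -/
theorem integral_smooth {g : Omega V → ℝ} (hg : Continuous g) :
    ∫ w, K.smooth g w ∂stat V = ∫ z, g z ∂stat V := by
  rw [← integral_mul_dens K.continuous_ker hg]
  refine integral_congr_ae (Eventually.of_forall fun z => ?_)
  simp [dens, K.integral_right]

/-- Jensen's inequality for the Markov kernel `K`. -/
theorem exp_smooth_le {g : Omega V → ℝ} (hg : Continuous g) (w : Omega V) :
    Real.exp (K.smooth g w) ≤ K.smooth (fun z => Real.exp (g z)) w := by
  set c := K.smooth g w with hc
  -- the tangent line of `exp` at the mean `c`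
  have h1 : ∀ z, Real.exp c * (g z - (c - 1)) ≤ Real.exp (g z) := fun z => by
    have h2 : Real.exp (g z) = Real.exp c * Real.exp (g z - c) := by
      rw [← Real.exp_add]; ring_nf
    rw [h2]
    have := Real.add_one_le_exp (g z - c)
    exact mul_le_mul_of_nonneg_left (by linarith) (Real.exp_pos c).le
  have h3 := K.smooth_mono (by fun_prop) (by fun_prop) h1 w
  have h4 : K.smooth (fun z => Real.exp c * (g z - (c - 1))) w = Real.exp c := by
    have h5 : K.smooth (fun z => Real.exp c * (g z - (c - 1))) w
        = Real.exp c * K.smooth (fun z => g z - (c - 1)) w := by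
      simp only [smooth, adj]
      rw [← integral_const_mul]
      refine integral_congr_ae (Eventually.of_forall fun z => ?_)
      simp only
      ring
    rw [h5, K.smooth_sub hg continuous_const, K.smooth_const, ← hc]
    ring
  rwa [h4] at h3

theorem dv_smooth {g : Omega V → ℝ} (hg : Continuous g) (w : Omega V) :
    dv (K.smooth g) w = K.smooth (dv g) w := by
  have h : K.smooth g (iota w) = K.smooth (fun z => g (iota z)) w := by
    simp only [smooth, adj]
    rw [← integral_comp_iota]
    refine integral_congr_ae (Eventually.of_forall fun z => ?_)
    simp only [K.ker_iota]
  unfold dv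
  rw [h, ← K.smooth_sub (by fun_prop) hg]

theorem hasDerivAt_smooth {g : Omega V → ℝ} (hg : Continuous g) (v : Vel V) (x : ℝ) :
    HasDerivAt (fun y : ℝ => K.smooth g ((y : UnitAddCircle), v))
      (-adj K.der g ((x : UnitAddCircle), v)) x := by
  have h := hasDerivAt_integral_circle (F := fun y z => K.ker z (y, v) * g z)
    (D := fun y z => -K.der z (y, v) * g z)
    (by have := K.continuous_ker; fun_prop) (by have := K.continuous_der; fun_prop)
    (fun x z => (K.hasDerivAt_right z x v).mul_const _) (stat V) x
  convert! h using 1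
  simp only [adj, neg_mul, integral_neg]

theorem dx_smooth {g : Omega V → ℝ} (hg : Continuous g) (w : Omega V) :
    dx (K.smooth g) w = -adj K.der g w := by
  obtain ⟨x, v⟩ := w
  induction x using QuotientAddGroup.induction_on with
  | H x => exact dx_of_hasDerivAt (K.hasDerivAt_smooth hg v x)

theorem isC10_smooth {g : Omega V → ℝ} (hg : Continuous g) : IsC10 (K.smooth g) := by
  intro v
  rw [contDiff_one_iff_deriv]
  refine ⟨fun x => (K.hasDerivAt_smooth hg v x).differentiableAt, ?_⟩
  have h : deriv (fun y : ℝ => K.smooth g ((y : UnitAddCircle), v))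
      = fun x : ℝ => -adj K.der g ((x : UnitAddCircle), v) :=
    funext fun x => (K.hasDerivAt_smooth hg v x).deriv
  rw [h]
  have := continuous_adj K.continuous_der hg
  fun_prop

theorem continuous_dx_smooth {g : Omega V → ℝ} (hg : Continuous g) :
    Continuous (dx (K.smooth g)) := by
  rw [funext (K.dx_smooth hg)]
  exact (continuous_adj K.continuous_der hg).neg

/-- The Hamiltonian of the mollified measure along the gradient of `φ`, with the spatial derivative
moved from `φ` to the mollified density. -/
def energy (lam : ℝ) (μ : ProbabilityMeasure (Omega V)) (φ : Omega V → ℝ) : ℝ :=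
  -(∫ z, (z.2 : ℝ) * φ z * dens K.der (μ : Measure (Omega V)) z ∂stat V)
    + lam * ∫ z, (Real.exp (dv φ z) - 1) * K.density μ z ∂stat V

/-- Mollifying the test function costs no more than mollifying the measure. -/
theorem hamiltonian_smooth_le {lam : ℝ} (hlam : 0 ≤ lam) (μ : ProbabilityMeasure (Omega V))
    {φ : Omega V → ℝ} (hφ : Continuous φ) :
    hamiltonian lam μ (dx (K.smooth φ)) (dv (K.smooth φ)) ≤ K.energy lam μ φ := by
  have hφv : Continuous fun z : Omega V => (z.2 : ℝ) * φ z := by fun_prop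
  have hdv := continuous_dv hφ
  have he : Continuous fun z => Real.exp (dv φ z) - 1 := by fun_prop
  have h1 : K.energy lam μ φ = ∫ w, (-adj K.der (fun z => (z.2 : ℝ) * φ z) w
      + lam * K.smooth (fun z => Real.exp (dv φ z) - 1) w) ∂(μ : Measure (Omega V)) := by
    unfold energy
    have := continuous_adj K.continuous_der hφv
    have := continuous_adj K.continuous_ker he
    rw [integral_mul_dens K.continuous_der hφv, integral_mul_dens K.continuous_ker he,
      integral_add (Continuous.integrable_of_compact (by fun_prop) _)
        (Continuous.integrable_of_compact (by fun_prop) _), integral_neg, integral_const_mul]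
  have c1 := continuous_adj K.continuous_der hφv
  have c2 := continuous_adj K.continuous_ker he
  have c3 := K.continuous_dx_smooth hφ
  have c4 := continuous_dv (continuous_adj K.continuous_ker hφ)
  rw [h1]
  unfold hamiltonian
  refine integral_mono (Continuous.integrable_of_compact (by fun_prop) _)
    (Continuous.integrable_of_compact (by fun_prop) _) fun w => ?_
  have h2 : (w.2 : ℝ) * dx (K.smooth φ) w = -adj K.der (fun z => (z.2 : ℝ) * φ z) w := by
    rw [K.dx_smooth hφ]
    simp only [adj, mul_neg, ← integral_const_mul]
    congr 2
    funext z
    linear_combination φ z * K.vel_mul_der z w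
  have h3 : Real.exp (dv (K.smooth φ) w) - 1 ≤ K.smooth (fun z => Real.exp (dv φ z) - 1) w := by
    rw [K.dv_smooth hφ, K.smooth_sub (by fun_prop) continuous_const, K.smooth_const]
    exact sub_le_sub_right (K.exp_smooth_le hdv w) 1
  simp only
  rw [h2]
  exact add_le_add_right (mul_le_mul_of_nonneg_left h3 hlam) _

/-- The Fisher information of the mollified measure. -/
def fisher (μ : ProbabilityMeasure (Omega V)) : ℝ :=
  2⁻¹ * ∫ z, (√(K.density μ (iota z)) - √(K.density μ z)) ^ 2 ∂stat V

/-- The entropy of the mollified measure. -/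
def entropy (μ : ProbabilityMeasure (Omega V)) : ℝ :=
  ∫ z, InformationTheory.klFun (K.density μ z) ∂stat V

/-- The optimal test function `½ log f`, for the mollified density `f`. -/
def potential (μ : ProbabilityMeasure (Omega V)) (z : Omega V) : ℝ :=
  2⁻¹ * Real.log (K.density μ z)

theorem continuous_density (μ : ProbabilityMeasure (Omega V)) : Continuous (K.density μ) :=
  continuous_dens K.continuous_ker μ

theorem continuous_potential (μ : ProbabilityMeasure (Omega V)) : Continuous (K.potential μ) := by
  unfold potential
  exact continuous_const.mul ((K.continuous_density μ).log fun z => (K.density_pos μ z).ne')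

theorem hasDerivAt_density (μ : ProbabilityMeasure (Omega V)) (v : Vel V) (x : ℝ) :
    HasDerivAt (fun y : ℝ => K.density μ ((y : UnitAddCircle), v))
      (dens K.der (μ : Measure (Omega V)) ((x : UnitAddCircle), v)) x :=
  hasDerivAt_integral_circle (F := fun y w => K.ker (y, v) w) (D := fun y w => K.der (y, v) w)
    (by have := K.continuous_ker; fun_prop) (by have := K.continuous_der; fun_prop)
    (fun x w => K.hasDerivAt_left x v w) (μ : Measure (Omega V)) x

/-- Transport does not change the entropy: `v log f ∂ₓ f` is the `x`-derivative of a function of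
`f`. -/
theorem integral_vel_mul_potential (μ : ProbabilityMeasure (Omega V)) :
    ∫ z, (z.2 : ℝ) * K.potential μ z * dens K.der (μ : Measure (Omega V)) z ∂stat V = 0 := by
  have c1 := K.continuous_potential μ
  have c2 := continuous_dens K.continuous_der μ
  have h : ∀ v : Vel V, ∫ x : UnitAddCircle,
      (v : ℝ) * K.potential μ (x, v) * dens K.der (μ : Measure (Omega V)) (x, v) = 0 := fun v => by
    refine integral_circle_deriv
      (G := fun x => (v : ℝ) * 2⁻¹ * InformationTheory.klFun (K.density μ (x, v))) (by fun_prop)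
      fun x => ?_
    have h1 := ((InformationTheory.hasDerivAt_klFun
      (K.density_pos μ ((x : UnitAddCircle), v)).ne').comp x (K.hasDerivAt_density μ v x)).const_mul
      ((v : ℝ) * 2⁻¹)
    convert! h1 using 1
    simp only [potential]
    ring
  rw [integral_stat (by fun_prop), h, h]
  simp

theorem energy_potential (lam : ℝ) (μ : ProbabilityMeasure (Omega V)) :
    K.energy lam μ (K.potential μ) = -(lam * K.fisher μ) := by
  have c := K.continuous_density μ
  have h1 : ∀ z, (Real.exp (dv (K.potential μ) z) - 1) * K.density μ z
      = √(K.density μ (iota z)) * √(K.density μ z) - K.density μ z := fun z => by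
    have ha := K.density_pos μ z
    have hb := K.density_pos μ (iota z)
    rw [dv, potential, potential, Real.exp_sub, exp_half_log ha, exp_half_log hb]
    have h3 := Real.sq_sqrt ha.le
    have h4 := Real.sqrt_pos.2 ha
    field_simp
    linear_combination (-√(K.density μ (iota z))) * h3
  have h5 : ∫ z, (√(K.density μ (iota z)) - √(K.density μ z)) ^ 2 ∂stat V
      = 2 * ∫ z, (K.density μ z - √(K.density μ (iota z)) * √(K.density μ z)) ∂stat V := by
    have h6 : ∀ z, (√(K.density μ (iota z)) - √(K.density μ z)) ^ 2
        = K.density μ (iota z) + (K.density μ z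
          - 2 * (√(K.density μ (iota z)) * √(K.density μ z))) := fun z => by
      have h3 := Real.sq_sqrt (K.density_pos μ z).le
      have h4 := Real.sq_sqrt (K.density_pos μ (iota z)).le
      linear_combination h3 + h4
    simp_rw [h6]
    rw [integral_add (Continuous.integrable_of_compact (by fun_prop) _)
      (Continuous.integrable_of_compact (by fun_prop) _), integral_comp_iota,
      integral_sub (Continuous.integrable_of_compact (by fun_prop) _)
      (Continuous.integrable_of_compact (by fun_prop) _),
      integral_sub (Continuous.integrable_of_compact (by fun_prop) _)
      (Continuous.integrable_of_compact (by fun_prop) _), integral_const_mul]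
    ring
  unfold energy fisher
  rw [K.integral_vel_mul_potential, h5]
  simp_rw [h1]
  rw [← mul_assoc 2⁻¹ 2, inv_mul_cancel₀ two_ne_zero, one_mul, neg_zero, zero_add, ← mul_neg,
    ← integral_neg]
  simp

end Mollifier

/-! ### The entropy inequality at the mollified level -/

/-- Along `σ`, on the time interval `[a, b]`, test functions grow at most at the rate prescribed by
the Hamiltonian, up to the increment of a cost `A`. -/
def HamiltonianBound (lam : ℝ) (σ : ℝ → ProbabilityMeasure (Omega V)) (A : ℝ → ℝ) (a b : ℝ) :
    Prop :=
  ∀ φ : Omega V → ℝ, IsC10 φ → Continuous φ → Continuous (dx φ) →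
    ∀ s t : ℝ, a ≤ s → s ≤ t → t ≤ b →
      (∫ z, φ z ∂(σ t : Measure (Omega V))) - ∫ z, φ z ∂(σ s : Measure (Omega V))
        ≤ A t - A s + ∫ r in s..t, hamiltonian lam (σ r) (dx φ) (dv φ)

theorem continuous_hamiltonian (lam : ℝ) {X : Type*} [TopologicalSpace X]
    {σ : X → ProbabilityMeasure (Omega V)} (hσ : Continuous σ) {φ₁ φ₂ : Omega V → ℝ}
    (h₁ : Continuous φ₁) (h₂ : Continuous φ₂) :
    Continuous fun r => hamiltonian lam (σ r) φ₁ φ₂ := by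
  unfold hamiltonian
  exact continuous_integral_of_continuous hσ
    (g := fun _ z => (z.2 : ℝ) * φ₁ z + lam * (Real.exp (φ₂ z) - 1)) (by fun_prop)

/-- A bound on the increments over short intervals sums up to a bound over long ones. -/
theorem sub_le_of_local_sub_le {F : ℝ → ℝ} {a b ε δ : ℝ} (hab : a ≤ b) (hδ : 0 < δ)
    (h : ∀ s t, a ≤ s → s ≤ t → t ≤ b → t - s < δ → F t - F s ≤ ε * (t - s)) :
    F b - F a ≤ ε * (b - a) := by
  obtain ⟨n, hn⟩ := exists_nat_gt ((b - a) / δ)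
  have hn0 : (0 : ℝ) < n := lt_of_le_of_lt (div_nonneg (sub_nonneg.2 hab) hδ.le) hn
  have hstep : (b - a) / n < δ := by
    rw [div_lt_iff₀ hn0]
    rw [div_lt_iff₀ hδ] at hn
    linarith
  have hh : 0 ≤ (b - a) / n := div_nonneg (sub_nonneg.2 hab) hn0.le
  set p : ℕ → ℝ := fun i => a + i * ((b - a) / n) with hp
  have hpn : p n = b := by simp only [hp]; field_simp; ring
  have hp0 : p 0 = a := by simp [hp]
  have hps : ∀ i, p (i + 1) - p i = (b - a) / n := fun i => by simp only [hp]; push_cast; ring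
  have key : ∀ i ∈ Finset.range n, F (p (i + 1)) - F (p i) ≤ ε * ((b - a) / n) := fun i hi => by
    have hi' : i + 1 ≤ n := Finset.mem_range.1 hi
    have h1 : a ≤ p i := le_add_of_nonneg_right (mul_nonneg (Nat.cast_nonneg i) hh)
    have h2 : p (i + 1) ≤ b := by
      rw [← hpn]
      have : ((i + 1 : ℕ) : ℝ) ≤ n := by exact_mod_cast hi'
      exact add_le_add_right (mul_le_mul_of_nonneg_right this hh) a
    have h3 := h (p i) (p (i + 1)) h1 (by linarith [hps i]) h2 (by rw [hps]; exact hstep)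
    rwa [hps] at h3
  have hsum := Finset.sum_le_sum key
  rw [Finset.sum_range_sub (fun i => F (p i)), hpn, hp0, Finset.sum_const, Finset.card_range,
    nsmul_eq_mul] at hsum
  calc F b - F a ≤ n * (ε * ((b - a) / n)) := hsum
    _ = ε * (b - a) := by field_simp

namespace Mollifier

variable (K : Mollifier V)

theorem continuous_energy_potential (lam : ℝ) {σ : ℝ → ProbabilityMeasure (Omega V)}
    (hσ : Continuous σ) :
    Continuous fun p : ℝ × ℝ => K.energy lam (σ p.1) (K.potential (σ p.2)) := by
  have c1 : Continuous fun q : ℝ × Omega V => K.density (σ q.1) q.2 :=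
    continuous_dens_family K.continuous_ker hσ
  have c2 : Continuous fun q : ℝ × Omega V => dens K.der (σ q.1 : Measure (Omega V)) q.2 :=
    continuous_dens_family K.continuous_der hσ
  have c3 : Continuous fun q : ℝ × Omega V => K.potential (σ q.1) q.2 := by
    unfold potential
    exact continuous_const.mul (c1.log fun q => (K.density_pos _ _).ne')
  have c4 : Continuous fun q : ℝ × Omega V => dv (K.potential (σ q.1)) q.2 := by
    unfold dv
    exact (c3.comp (f := fun q : ℝ × Omega V => (q.1, iota q.2)) (by fun_prop)).sub c3
  unfold energy
  refine (continuous_integral_stat ?_).neg.add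
    (continuous_const.mul (continuous_integral_stat ?_))
  · exact (((continuous_vel.comp continuous_snd).mul
      (c3.comp (f := fun q : (ℝ × ℝ) × Omega V => (q.1.2, q.2)) (by fun_prop))).mul
      (c2.comp (f := fun q : (ℝ × ℝ) × Omega V => (q.1.1, q.2)) (by fun_prop)))
  · exact (((c4.comp (f := fun q : (ℝ × ℝ) × Omega V => (q.1.2, q.2)) (by fun_prop)).rexp.sub
      continuous_const).mul
      (c1.comp (f := fun q : (ℝ × ℝ) × Omega V => (q.1.1, q.2)) (by fun_prop)))

theorem continuous_fisher {σ : ℝ → ProbabilityMeasure (Omega V)} (hσ : Continuous σ) :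
    Continuous fun r => K.fisher (σ r) := by
  have c1 : Continuous fun q : ℝ × Omega V => K.density (σ q.1) q.2 :=
    continuous_dens_family K.continuous_ker hσ
  unfold fisher
  refine continuous_const.mul (continuous_integral_stat ?_)
  exact (((c1.comp (f := fun q : ℝ × Omega V => (q.1, iota q.2)) (by fun_prop)).sqrt).sub
    c1.sqrt).pow 2

theorem fisher_nonneg (μ : ProbabilityMeasure (Omega V)) : 0 ≤ K.fisher μ :=
  mul_nonneg (by norm_num) (integral_nonneg fun _ => sq_nonneg _)

theorem entropy_nonneg (μ : ProbabilityMeasure (Omega V)) :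
    0 ≤ K.entropy μ :=
  integral_nonneg fun z => InformationTheory.klFun_nonneg (K.density_pos μ z).le

/-- Convexity of the entropy: its increment is at most the increment of the integral of its
derivative at the final measure. -/
theorem entropy_sub_le (μ ν : ProbabilityMeasure (Omega V)) :
    2⁻¹ * K.entropy ν - 2⁻¹ * K.entropy μ
      ≤ (∫ w, K.smooth (K.potential ν) w ∂(ν : Measure (Omega V)))
        - ∫ w, K.smooth (K.potential ν) w ∂(μ : Measure (Omega V)) := by
  have cp := K.continuous_potential ν
  have cν := K.continuous_density ν
  have cμ := K.continuous_density μ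
  have ck := InformationTheory.continuous_klFun
  rw [← integral_mul_dens K.continuous_ker cp, ← integral_mul_dens K.continuous_ker cp,
    ← integral_sub (Continuous.integrable_of_compact (by fun_prop) _)
      (Continuous.integrable_of_compact (by fun_prop) _)]
  unfold entropy
  rw [← mul_sub, ← integral_sub (Continuous.integrable_of_compact (by fun_prop) _)
      (Continuous.integrable_of_compact (by fun_prop) _), ← integral_const_mul]
  refine integral_mono (Continuous.integrable_of_compact (by fun_prop) _)
    (Continuous.integrable_of_compact (by fun_prop) _) fun z => ?_
  have ha := K.density_pos μ z
  have hb := K.density_pos ν z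
  have h1 := Real.log_le_sub_one_of_pos (div_pos hb ha)
  rw [Real.log_div hb.ne' ha.ne', div_sub_one ha.ne', le_div_iff₀ ha] at h1
  simp only [potential, InformationTheory.klFun]
  simp only [density] at h1 ⊢
  linarith

/-- The entropy inequality at the mollified level. -/
theorem entropy_add_fisher_le {lam : ℝ} (hlam : 0 ≤ lam)
    {σ : ℝ → ProbabilityMeasure (Omega V)} (hσ : Continuous σ) {A : ℝ → ℝ} {a b : ℝ}
    (hab : a ≤ b) (H : HamiltonianBound lam σ A a b) :
    2⁻¹ * K.entropy (σ b) + lam * ∫ r in a..b, K.fisher (σ r)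
      ≤ 2⁻¹ * K.entropy (σ a) + (A b - A a) := by
  have cE := K.continuous_energy_potential lam hσ
  have cF := K.continuous_fisher hσ
  -- testing the Hamiltonian bound with the mollified potential at the final time
  have step : ∀ s t, a ≤ s → s ≤ t → t ≤ b →
      2⁻¹ * K.entropy (σ t) - 2⁻¹ * K.entropy (σ s)
        ≤ A t - A s + ∫ r in s..t, K.energy lam (σ r) (K.potential (σ t)) := by
    intro s t has hst htb
    have cp := K.continuous_potential (σ t)
    have cs : Continuous (K.smooth (K.potential (σ t))) := continuous_adj K.continuous_ker cp
    have cd := K.continuous_dx_smooth cp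
    refine (K.entropy_sub_le _ _).trans ((H _ (K.isC10_smooth cp) cs cd s t has hst htb).trans ?_)
    refine add_le_add_right (intervalIntegral.integral_mono_on hst
      ((continuous_hamiltonian lam hσ cd (continuous_dv cs)).intervalIntegrable _ _)
      ((cE.comp (f := fun r : ℝ => (r, t)) (by fun_prop)).intervalIntegrable _ _)
      fun r _ => K.hamiltonian_smooth_le hlam _ cp) _
  suffices h : ∀ ε : ℝ, 0 < ε → 2⁻¹ * K.entropy (σ b) + lam * ∫ r in a..b, K.fisher (σ r)
      ≤ 2⁻¹ * K.entropy (σ a) + (A b - A a) + ε * (b - a) by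
    have hlim : Tendsto (fun ε : ℝ => 2⁻¹ * K.entropy (σ a) + (A b - A a) + ε * (b - a)) (𝓝[>] 0)
        (𝓝 (2⁻¹ * K.entropy (σ a) + (A b - A a))) := by
      refine tendsto_nhdsWithin_of_tendsto_nhds ?_
      have : Continuous fun ε : ℝ => 2⁻¹ * K.entropy (σ a) + (A b - A a) + ε * (b - a) := by
        fun_prop
      simpa using this.tendsto 0
    exact ge_of_tendsto hlim (eventually_nhdsWithin_of_forall fun ε hε => h ε hε)
  intro ε hε
  have hunif := (isCompact_Icc.prod isCompact_Icc :
    IsCompact (Icc a b ×ˢ Icc a b)).uniformContinuousOn_of_continuous cE.continuousOn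
  obtain ⟨δ, hδ, hclose⟩ := Metric.uniformContinuousOn_iff.1 hunif ε hε
  have hloc : ∀ s t, a ≤ s → s ≤ t → t ≤ b → t - s < δ →
      (2⁻¹ * K.entropy (σ t) - A t + lam * ∫ r in a..t, K.fisher (σ r))
        - (2⁻¹ * K.entropy (σ s) - A s + lam * ∫ r in a..s, K.fisher (σ r)) ≤ ε * (t - s) := by
    intro s t has hst htb hts
    have h1 := step s t has hst htb
    have h2 : ∫ r in s..t, K.energy lam (σ r) (K.potential (σ t))
        ≤ ∫ r in s..t, (ε + -(lam * K.fisher (σ r))) := by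
      refine intervalIntegral.integral_mono_on hst
        ((cE.comp (f := fun r : ℝ => (r, t)) (by fun_prop)).intervalIntegrable _ _)
        (Continuous.intervalIntegrable (by fun_prop) _ _) fun r hr => ?_
      have hr' : r ∈ Icc a b := ⟨has.trans hr.1, hr.2.trans htb⟩
      have h3 := hclose (r, t) ⟨hr', has.trans hst, htb⟩ (r, r) ⟨hr', hr'⟩ (by
        rw [Prod.dist_eq, dist_self, max_eq_right dist_nonneg, Real.dist_eq,
          abs_of_nonneg (by linarith [hr.2])]
        linarith [hr.1])
      rw [Real.dist_eq] at h3
      have h4 := (abs_lt.1 h3).2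
      simp only [K.energy_potential] at h4
      linarith
    have h5 : ∫ r in s..t, (ε + -(lam * K.fisher (σ r)))
        = ε * (t - s) - lam * ∫ r in s..t, K.fisher (σ r) := by
      rw [intervalIntegral.integral_add (Continuous.intervalIntegrable (by fun_prop) _ _)
        (Continuous.intervalIntegrable (by fun_prop) _ _), intervalIntegral.integral_const,
        intervalIntegral.integral_neg, intervalIntegral.integral_const_mul, smul_eq_mul]
      ring
    have h6 := intervalIntegral.integral_add_adjacent_intervals (cF.intervalIntegrable a s)
      (cF.intervalIntegrable s t) (μ := volume)
    rw [← h6]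
    rw [h5] at h2
    linarith
  have h7 := sub_le_of_local_sub_le hab hδ hloc
  rw [intervalIntegral.integral_same] at h7
  linarith

end Mollifier

/-! ### Existence of mollifiers -/

theorem velPos_ne_velNeg (hV : 0 < V) : velPos V ≠ velNeg V := fun h => by
  have h' : V = -V := congrArg Subtype.val h
  linarith

theorem flip_injective : Function.Injective (Vel.flip (V := V)) := fun v w h => by
  rw [← flip_flip v, h, flip_flip]

/-- The weight `2 · 1_{v = v'}`, the density of the Dirac mass at `v'` with respect to the uniform
distribution of velocities. -/
def velWeight (v v' : Vel V) : ℝ := open Classical in if v = v' then 2 else 0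

theorem velWeight_nonneg (v v' : Vel V) : 0 ≤ velWeight v v' := by
  unfold velWeight; split_ifs <;> norm_num

theorem velWeight_comm (v v' : Vel V) : velWeight v v' = velWeight v' v := by
  simp only [velWeight, eq_comm]

theorem velWeight_flip (v v' : Vel V) : velWeight v.flip v'.flip = velWeight v v' := by
  simp only [velWeight, flip_injective.eq_iff]

theorem vel_mul_velWeight (v v' : Vel V) :
    (v' : ℝ) * velWeight v v' = (v : ℝ) * velWeight v v' := by
  unfold velWeight
  split_ifs with h
  · rw [h]
  · simp

theorem continuous_velWeight :
    Continuous fun p : Vel V × Vel V => velWeight p.1 p.2 := continuous_of_discreteTopology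

theorem integral_velWeight_mul (hV : 0 < V) {g : Omega V → ℝ} (hg : Continuous g) (v' : Vel V) :
    ∫ z, velWeight z.2 v' * g z ∂stat V = ∫ x, g (x, v') := by
  have hne := velPos_ne_velNeg hV
  have hc : Continuous fun z : Omega V => velWeight z.2 v' * g z :=
    (continuous_velWeight.comp (f := fun z : Omega V => (z.2, v')) (by fun_prop)).mul hg
  rw [integral_stat hc]
  rcases vel_eq v' with rfl | rfl
  · simp only [velWeight, if_true, if_neg hne.symm, zero_mul, integral_zero, integral_const_mul]
    ring
  · simp only [velWeight, if_true, if_neg hne, zero_mul, integral_zero, integral_const_mul]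
    ring

/-- The mollifier built from a probability density `ρ` on the circle: convolution with `ρ` in the
space variable, mixed with a fraction `ε` of the uniform distribution, which makes it positive. -/
def Mollifier.ofDensity (hV : 0 < V) {ρ ρ' : UnitAddCircle → ℝ} (hρ : Continuous ρ)
    (hρ' : Continuous ρ') (hρ0 : ∀ x, 0 ≤ ρ x) (hρ1 : ∫ x, ρ x = 1)
    (hd : ∀ x : ℝ, HasDerivAt (fun y : ℝ => ρ (y : UnitAddCircle)) (ρ' (x : UnitAddCircle)) x)
    {ε : ℝ} (hε0 : 0 < ε) (hε1 : ε ≤ 1) : Mollifier V where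
  ker z w := (1 - ε) * (velWeight z.2 w.2 * ρ (z.1 - w.1)) + ε
  der z w := (1 - ε) * (velWeight z.2 w.2 * ρ' (z.1 - w.1))
  continuous_ker := by
    have := (continuous_velWeight (V := V)).comp
      (f := fun p : Omega V × Omega V => (p.1.2, p.2.2)) (by fun_prop)
    exact (continuous_const.mul (this.mul (by fun_prop))).add continuous_const
  continuous_der := by
    have := (continuous_velWeight (V := V)).comp
      (f := fun p : Omega V × Omega V => (p.1.2, p.2.2)) (by fun_prop)
    exact continuous_const.mul (this.mul (by fun_prop))
  pos z w := add_pos_of_nonneg_of_pos (mul_nonneg (by linarith)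
    (mul_nonneg (velWeight_nonneg _ _) (hρ0 _))) hε0
  integral_left w := by
    have hc : Continuous fun z : Omega V => velWeight z.2 w.2 * ρ (z.1 - w.1) :=
      (continuous_velWeight.comp (f := fun z : Omega V => (z.2, w.2)) (by fun_prop)).mul
        (by fun_prop)
    rw [integral_add (Continuous.integrable_of_compact (by fun_prop) _) (integrable_const _),
      integral_const_mul,
      integral_velWeight_mul hV (g := fun z => ρ (z.1 - w.1)) (by fun_prop) w.2]
    simp only
    rw [integral_sub_right_eq_self ρ w.1, hρ1]
    simp
  integral_right z := by
    have hc : Continuous fun w : Omega V => velWeight w.2 z.2 * ρ (z.1 - w.1) :=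
      (continuous_velWeight.comp (f := fun w : Omega V => (w.2, z.2)) (by fun_prop)).mul
        (by fun_prop)
    simp only [velWeight_comm z.2]
    rw [integral_add (Continuous.integrable_of_compact (by fun_prop) _) (integrable_const _),
      integral_const_mul,
      integral_velWeight_mul hV (g := fun w => ρ (z.1 - w.1)) (by fun_prop) z.2]
    simp only
    rw [integral_sub_left_eq_self ρ _ z.1, hρ1]
    simp
  ker_iota z w := by simp only [iota, velWeight_flip]
  hasDerivAt_left x v w := by
    obtain ⟨y, v'⟩ := w
    induction y using QuotientAddGroup.induction_on with
    | H y =>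
      have h := HasDerivAt.comp_sub_const x y (hd (x - y))
      simpa using ((h.const_mul (velWeight v v')).const_mul (1 - ε)).add_const ε
  hasDerivAt_right z x v := by
    obtain ⟨y, v'⟩ := z
    induction y using QuotientAddGroup.induction_on with
    | H y =>
      have h := HasDerivAt.comp_const_sub y x (hd (y - x))
      simpa using ((h.const_mul (velWeight v' v)).const_mul (1 - ε)).add_const ε
  vel_mul_der z w := by
    linear_combination (1 - ε) * ρ' (z.1 - w.1) * vel_mul_velWeight z.2 w.2

theorem Mollifier.smooth_ofDensity (hV : 0 < V) {ρ ρ' : UnitAddCircle → ℝ} (hρ : Continuous ρ)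
    (hρ' : Continuous ρ') (hρ0 : ∀ x, 0 ≤ ρ x) (hρ1 : ∫ x, ρ x = 1)
    (hd : ∀ x : ℝ, HasDerivAt (fun y : ℝ => ρ (y : UnitAddCircle)) (ρ' (x : UnitAddCircle)) x)
    {ε : ℝ} (hε0 : 0 < ε) (hε1 : ε ≤ 1) {g : Omega V → ℝ} (hg : Continuous g) (w : Omega V) :
    (Mollifier.ofDensity hV hρ hρ' hρ0 hρ1 hd hε0 hε1).smooth g w
      = (1 - ε) * (∫ x, ρ x * g (x + w.1, w.2)) + ε * ∫ z, g z ∂stat V := by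
  have hc : Continuous fun z : Omega V => velWeight z.2 w.2 * (ρ (z.1 - w.1) * g z) :=
    (continuous_velWeight.comp (f := fun z : Omega V => (z.2, w.2)) (by fun_prop)).mul
      (by fun_prop)
  have h1 : ∀ z : Omega V, ((1 - ε) * (velWeight z.2 w.2 * ρ (z.1 - w.1)) + ε) * g z
      = (1 - ε) * (velWeight z.2 w.2 * (ρ (z.1 - w.1) * g z)) + ε * g z := fun z => by ring
  simp only [smooth, adj, ofDensity, h1]
  rw [integral_add (Continuous.integrable_of_compact (by fun_prop) _)
    (Continuous.integrable_of_compact (by fun_prop) _), integral_const_mul, integral_const_mul,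
    integral_velWeight_mul hV (g := fun z => ρ (z.1 - w.1) * g z) (by fun_prop) w.2]
  simp only
  rw [← integral_add_right_eq_self (fun x => ρ (x - w.1) * g (x, w.2)) w.1]
  simp only [add_sub_cancel_right]

/-- The function `(1 + cos (2 π x)) / 2` on the circle, whose powers are approximately
concentrated at its maximum point `0`. -/
def bump : UnitAddCircle → ℝ :=
  Function.Periodic.lift (f := fun s : ℝ => (1 + Real.cos (2 * Real.pi * s)) / 2) (c := 1)
    fun s => by
      simp only
      rw [mul_add, mul_one, Real.cos_add_two_pi]

/-- The derivative of `bump`. -/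
def bumpDeriv : UnitAddCircle → ℝ :=
  Function.Periodic.lift (f := fun s : ℝ => -(Real.pi * Real.sin (2 * Real.pi * s))) (c := 1)
    fun s => by
      simp only
      rw [mul_add, mul_one, Real.sin_add_two_pi]

theorem bump_coe (s : ℝ) : bump (s : UnitAddCircle) = (1 + Real.cos (2 * Real.pi * s)) / 2 := rfl

theorem bumpDeriv_coe (s : ℝ) :
    bumpDeriv (s : UnitAddCircle) = -(Real.pi * Real.sin (2 * Real.pi * s)) := rfl

theorem continuous_bump : Continuous bump :=
  (QuotientAddGroup.isQuotientMap_mk _).continuous_iff.2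
    (by change Continuous fun s : ℝ => (1 + Real.cos (2 * Real.pi * s)) / 2; fun_prop)

theorem continuous_bumpDeriv : Continuous bumpDeriv :=
  (QuotientAddGroup.isQuotientMap_mk _).continuous_iff.2
    (by change Continuous fun s : ℝ => -(Real.pi * Real.sin (2 * Real.pi * s)); fun_prop)

theorem bump_nonneg (x : UnitAddCircle) : 0 ≤ bump x := by
  induction x using QuotientAddGroup.induction_on with
  | H s => rw [bump_coe]; linarith [Real.neg_one_le_cos (2 * Real.pi * s)]

theorem bump_zero : bump 0 = 1 := by
  have := bump_coe 0
  simpa using this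

theorem bump_lt {x : UnitAddCircle} (hx : x ≠ 0) : bump x < bump 0 := by
  induction x using QuotientAddGroup.induction_on with
  | H s =>
    rw [bump_zero, bump_coe]
    have h1 := Real.cos_le_one (2 * Real.pi * s)
    refine lt_of_le_of_ne (by linarith) fun h => hx ?_
    obtain ⟨n, hn⟩ := (Real.cos_eq_one_iff (2 * Real.pi * s)).1 (by linarith)
    have hs : s = n := by
      have := Real.pi_pos
      have h2 : (2 * Real.pi) * (n - s) = 0 := by linarith
      rcases mul_eq_zero.1 h2 with h3 | h3
      · linarith
      · linarith
    rw [hs]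
    exact (AddCircle.coe_eq_zero_iff 1).2 ⟨n, by simp⟩

theorem hasDerivAt_bump (x : ℝ) :
    HasDerivAt (fun y : ℝ => bump (y : UnitAddCircle)) (bumpDeriv (x : UnitAddCircle)) x := by
  simp only [bump_coe, bumpDeriv_coe]
  have h := ((((hasDerivAt_id x).const_mul (2 * Real.pi)).cos).const_add 1).div_const 2
  convert! h using 1
  simp only [id]
  ring

theorem integral_bump_pow_pos (n : ℕ) : 0 < ∫ x, bump x ^ n :=
  Continuous.integral_pos_of_hasCompactSupport_nonneg_nonzero (x := 0)
    (continuous_bump.pow n) (HasCompactSupport.of_compactSpace _)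
    (fun x => pow_nonneg (bump_nonneg x) n) (by simp [bump_zero])

theorem exists_mollifier_seq (hV : 0 < V) : ∃ K : ℕ → Mollifier V,
    ∀ g : Omega V → ℝ, Continuous g → ∀ w, Tendsto (fun n => (K n).smooth g w) atTop (𝓝 (g w)) := by
  have hε0 : ∀ n : ℕ, (0 : ℝ) < 1 / ((n : ℝ) + 1) := fun n => by positivity
  have hε1 : ∀ n : ℕ, 1 / ((n : ℝ) + 1) ≤ 1 := fun n => by
    rw [div_le_one (by positivity)]
    linarith [(Nat.cast_nonneg n : (0 : ℝ) ≤ n)]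
  have c := continuous_bump
  have c' := continuous_bumpDeriv
  refine ⟨fun n => Mollifier.ofDensity hV
    (ρ := fun x => (∫ y, bump y ^ n)⁻¹ * bump x ^ n)
    (ρ' := fun x => (∫ y, bump y ^ n)⁻¹ * (n * bump x ^ (n - 1) * bumpDeriv x))
    (by fun_prop) (by fun_prop)
    (fun x => mul_nonneg (inv_nonneg.2 (integral_bump_pow_pos n).le)
      (pow_nonneg (bump_nonneg x) n))
    (by rw [integral_const_mul, inv_mul_cancel₀ (integral_bump_pow_pos n).ne'])
    (fun x => ((hasDerivAt_bump x).pow n).const_mul _)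
    (hε0 n) (hε1 n), fun g hg w => ?_⟩
  simp only [Mollifier.smooth_ofDensity hV _ _ _ _ _ _ _ hg]
  have hε := tendsto_one_div_add_atTop_nhds_zero_nat (𝕜 := ℝ)
  have hpeak := tendsto_setIntegral_pow_smul_of_unique_maximum_of_isCompact_of_continuousOn
    (μ := (volume : Measure UnitAddCircle)) isCompact_univ (x₀ := 0) c.continuousOn
    (fun y _ hy => bump_lt hy) (fun x _ => bump_nonneg x) (by rw [bump_zero]; exact one_pos)
    (by simp) (g := fun x => g (x + w.1, w.2)) (Continuous.continuousOn (by fun_prop))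
  simp only [Measure.restrict_univ, smul_eq_mul, zero_add, ← integral_const_mul,
    ← mul_assoc] at hpeak
  have := ((tendsto_const_nhds (x := (1 : ℝ))).sub hε).mul hpeak |>.add
    (hε.mul (tendsto_const_nhds (x := ∫ z, g z ∂stat V)))
  simpa using this

/-! ### Dual bound for the relative entropy -/

/-- Bounded measurable functions are almost everywhere limits of continuous functions with the same
bound. -/
theorem exists_continuous_tendsto_ae (μ : Measure (Omega V)) [IsFiniteMeasure μ]
    {G : Omega V → ℝ} (hG : Measurable G) {M : ℝ} (hM : ∀ z, |G z| ≤ M) :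
    ∃ g : ℕ → Omega V → ℝ, (∀ n, Continuous (g n)) ∧ (∀ n z, |g n z| ≤ M) ∧
      ∀ᵐ z ∂μ, Tendsto (fun n => g n z) atTop (𝓝 (G z)) := by
  have hmem : MemLp G 1 μ := by
    refine MemLp.of_bound hG.aestronglyMeasurable M (Eventually.of_forall fun z => ?_)
    exact hM z
  have hne : ∀ n : ℕ, ((n : ℝ≥0∞) + 1)⁻¹ ≠ 0 := fun n => by simp
  choose h hh hhm using fun n : ℕ =>
    hmem.exists_boundedContinuous_eLpNorm_sub_le ENNReal.one_ne_top (hne n)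
  have hlim : Tendsto (fun n => eLpNorm ((h n : Omega V → ℝ) - G) 1 μ) atTop (𝓝 0) := by
    have h0 : Tendsto (fun n : ℕ => ((n : ℝ≥0∞) + 1)⁻¹) atTop (𝓝 0) := by
      have := (tendsto_add_atTop_iff_nat 1).2 ENNReal.tendsto_inv_nat_nhds_zero
      simpa using this
    refine tendsto_of_tendsto_of_tendsto_of_le_of_le tendsto_const_nhds h0 (fun _ => zero_le)
      fun n => ?_
    simp only
    rw [eLpNorm_sub_comm]
    exact hh n
  obtain ⟨ns, -, hns⟩ := (tendstoInMeasure_of_tendsto_eLpNorm one_ne_zero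
    (fun n => (hhm n).aestronglyMeasurable) hG.aestronglyMeasurable hlim).exists_seq_tendsto_ae
  refine ⟨fun n z => max (-M) (min (h (ns n) z) M), fun n => by fun_prop, fun n z => ?_, ?_⟩
  · have hM0 : 0 ≤ M := (abs_nonneg _).trans (hM z)
    exact abs_le.2 ⟨le_max_left _ _, max_le (by linarith) (min_le_right _ _)⟩
  · filter_upwards [hns] with z hz
    have h1 := (tendsto_const_nhds (x := -M)).max (hz.min (tendsto_const_nhds (x := M)))
    rwa [min_eq_left (abs_le.1 (hM z)).2, max_eq_right (abs_le.1 (hM z)).1] at h1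

/-- Truncation of `a` to the interval `[1 / (n + 1), n + 1]`. -/
def trunc (n : ℕ) (a : ℝ) : ℝ := max (1 / ((n : ℝ) + 1)) (min a ((n : ℝ) + 1))

theorem trunc_ge (n : ℕ) (a : ℝ) : 1 / ((n : ℝ) + 1) ≤ trunc n a := le_max_left _ _

theorem trunc_pos (n : ℕ) (a : ℝ) : 0 < trunc n a :=
  lt_of_lt_of_le (by positivity) (trunc_ge n a)

theorem one_div_le_one (n : ℕ) : 1 / ((n : ℝ) + 1) ≤ 1 := by
  rw [div_le_one (by positivity)]
  linarith [(Nat.cast_nonneg n : (0 : ℝ) ≤ n)]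

theorem trunc_le (n : ℕ) (a : ℝ) : trunc n a ≤ (n : ℝ) + 1 :=
  max_le ((one_div_le_one n).trans (by linarith [(Nat.cast_nonneg n : (0 : ℝ) ≤ n)]))
    (min_le_right _ _)

theorem trunc_mono (n : ℕ) {a b : ℝ} (h : a ≤ b) : trunc n a ≤ trunc n b :=
  max_le_max le_rfl (min_le_min h le_rfl)

theorem trunc_one (n : ℕ) : trunc n 1 = 1 := by
  unfold trunc
  rw [min_eq_left (by linarith [(Nat.cast_nonneg n : (0 : ℝ) ≤ n)]),
    max_eq_right (one_div_le_one n)]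

theorem mul_trunc_le (n : ℕ) {a b : ℝ} (ha : 0 ≤ a) (h : a ≤ b) :
    a * trunc n b ≤ b * trunc n a := by
  unfold trunc
  rw [mul_max_of_nonneg _ _ ha, mul_max_of_nonneg _ _ (ha.trans h), mul_min_of_nonneg _ _ ha,
    mul_min_of_nonneg _ _ (ha.trans h), mul_comm a b]
  have h1 : 0 ≤ 1 / ((n : ℝ) + 1) := by positivity
  exact max_le_max (mul_le_mul_of_nonneg_right h h1)
    (min_le_min le_rfl (mul_le_mul_of_nonneg_right h (by positivity)))

@[fun_prop]
theorem continuous_trunc (n : ℕ) : Continuous (trunc n) := by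
  unfold trunc; fun_prop

theorem tendsto_trunc {a : ℝ} (ha : 0 ≤ a) : Tendsto (fun n => trunc n a) atTop (𝓝 a) := by
  have h1 : Tendsto (fun n : ℕ => min a ((n : ℝ) + 1)) atTop (𝓝 a) := by
    refine tendsto_const_nhds.congr' ?_
    filter_upwards [eventually_ge_atTop ⌈a⌉₊] with n hn
    rw [min_eq_left]
    have : (⌈a⌉₊ : ℝ) ≤ n := by exact_mod_cast hn
    linarith [Nat.le_ceil a]
  have h2 := (tendsto_one_div_add_atTop_nhds_zero_nat (𝕜 := ℝ)).max h1
  rwa [max_eq_right ha] at h2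

theorem abs_log_trunc_le (n : ℕ) (a : ℝ) : |Real.log (trunc n a)| ≤ Real.log ((n : ℝ) + 1) := by
  have h0 : (0 : ℝ) < (n : ℝ) + 1 := by positivity
  refine abs_le.2 ⟨?_, Real.log_le_log (trunc_pos n a) (trunc_le n a)⟩
  rw [← Real.log_inv, inv_eq_one_div]
  exact Real.log_le_log (by positivity) (trunc_ge n a)

/-- The truncation lies between `a` and the point `1` where the entropy density vanishes. -/
theorem young_trunc_nonneg (n : ℕ) (a : ℝ) :
    0 ≤ a * Real.log (trunc n a) - (trunc n a - 1) := by
  have hc := trunc_pos n a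
  set c := trunc n a with hcdef
  have h1 : c - 1 ≤ c * Real.log c := by
    have := Real.one_sub_inv_le_log_of_pos hc
    have h2 := mul_le_mul_of_nonneg_left this hc.le
    rwa [mul_sub, mul_inv_cancel₀ hc.ne', mul_one] at h2
  have h3 : 0 ≤ (a - c) * Real.log c := by
    rcases le_total a 1 with ha | ha
    · have hc1 : c ≤ 1 := by rw [hcdef, ← trunc_one n]; exact trunc_mono n ha
      have hac : a ≤ c := by
        refine le_max_of_le_right (le_min le_rfl ?_)
        linarith [(Nat.cast_nonneg n : (0 : ℝ) ≤ n)]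
      exact mul_nonneg_of_nonpos_of_nonpos (by linarith) (Real.log_nonpos hc.le hc1)
    · have hc1 : 1 ≤ c := by rw [hcdef, ← trunc_one n]; exact trunc_mono n ha
      have hac : c ≤ a := max_le ((one_div_le_one n).trans ha) (min_le_left _ _)
      exact mul_nonneg (by linarith) (Real.log_nonneg hc1)
  linarith

theorem tendsto_young_trunc {a : ℝ} (ha : 0 ≤ a) :
    Tendsto (fun n => a * Real.log (trunc n a) - (trunc n a - 1)) atTop
      (𝓝 (InformationTheory.klFun a)) := by
  have h1 := tendsto_trunc ha
  have h2 : Tendsto (fun n => a * Real.log (trunc n a)) atTop (𝓝 (a * Real.log a)) := by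
    rcases ha.eq_or_lt with rfl | ha
    · simp
    · exact tendsto_const_nhds.mul ((Real.continuousAt_log ha.ne').tendsto.comp h1)
  have h3 := h2.sub (h1.sub_const 1)
  convert! h3 using 2
  rw [InformationTheory.klFun]
  ring

/-- The duality bound for bounded measurable test functions follows from the one for continuous test
functions. -/
theorem ofReal_entropy_dual_le (μ : ProbabilityMeasure (Omega V)) {c : ℝ≥0∞}
    (h : ∀ g : Omega V → ℝ, Continuous g →
      ENNReal.ofReal ((∫ z, g z ∂(μ : Measure (Omega V))) - ∫ z, (Real.exp (g z) - 1) ∂stat V) ≤ c)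
    {G : Omega V → ℝ} (hG : Measurable G) {M : ℝ} (hM : ∀ z, |G z| ≤ M) :
    ENNReal.ofReal ((∫ z, G z ∂(μ : Measure (Omega V))) - ∫ z, (Real.exp (G z) - 1) ∂stat V)
      ≤ c := by
  obtain ⟨g, hgc, hgM, hg⟩ :=
    exists_continuous_tendsto_ae ((μ : Measure (Omega V)) + stat V) hG hM
  rw [ae_add_measure_iff] at hg
  have h1 : Tendsto (fun n => ∫ z, g n z ∂(μ : Measure (Omega V))) atTop
      (𝓝 (∫ z, G z ∂(μ : Measure (Omega V)))) :=
    tendsto_integral_of_dominated_convergence (fun _ => M)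
      (fun n => (hgc n).aestronglyMeasurable) (integrable_const _)
      (fun n => Eventually.of_forall fun z => hgM n z) hg.1
  have h2 : Tendsto (fun n => ∫ z, (Real.exp (g n z) - 1) ∂stat V) atTop
      (𝓝 (∫ z, (Real.exp (G z) - 1) ∂stat V)) := by
    refine tendsto_integral_of_dominated_convergence (fun _ => Real.exp M + 1)
      (fun n => Continuous.aestronglyMeasurable (by have := hgc n; fun_prop))
      (integrable_const _) (fun n => Eventually.of_forall fun z => ?_) ?_
    · refine (norm_sub_le _ _).trans ?_
      rw [Real.norm_eq_abs, Real.abs_exp, norm_one]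
      exact add_le_add_left (Real.exp_le_exp.2 (abs_le.1 (hgM n z)).2) 1
    · filter_upwards [hg.2] with z hz
      exact ((Real.continuous_exp.tendsto _).comp hz).sub_const 1
  exact le_of_tendsto ((ENNReal.continuous_ofReal.tendsto _).comp (h1.sub h2))
    (Eventually.of_forall fun n => h (g n) (hgc n))

/-- Dual characterization of the relative entropy: it is dominated by every bound on
`∫ g dμ - ∫ (exp g - 1) dπ` that is uniform over continuous `g`. -/
theorem Ent_le_of_forall (μ : ProbabilityMeasure (Omega V)) {c : ℝ≥0∞}
    (h : ∀ g : Omega V → ℝ, Continuous g →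
      ENNReal.ofReal ((∫ z, g z ∂(μ : Measure (Omega V))) - ∫ z, (Real.exp (g z) - 1) ∂stat V)
        ≤ c) :
    Ent (μ : Measure (Omega V)) (stat V) ≤ c := by
  by_cases hac : (μ : Measure (Omega V)) ≪ stat V
  · set f : Omega V → ℝ := fun z => ((μ : Measure (Omega V)).rnDeriv (stat V) z).toReal with hf
    have hfm : Measurable f := (Measure.measurable_rnDeriv _ _).ennreal_toReal
    have hfi : Integrable f (stat V) := Measure.integrable_toReal_rnDeriv
    have hf0 : ∀ z, 0 ≤ f z := fun z => ENNReal.toReal_nonneg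
    have hGm : ∀ n, Measurable fun z => Real.log (trunc n (f z)) := fun n =>
      Real.measurable_log.comp ((continuous_trunc n).measurable.comp hfm)
    have hbound : ∀ n, ∫⁻ z, ENNReal.ofReal
        (f z * Real.log (trunc n (f z)) - (trunc n (f z) - 1)) ∂stat V ≤ c := fun n => by
      have h1 := ofReal_entropy_dual_le μ h (hGm n) (fun z => abs_log_trunc_le n (f z))
      have h2 : ∫ z, Real.log (trunc n (f z)) ∂(μ : Measure (Omega V))
          = ∫ z, f z * Real.log (trunc n (f z)) ∂stat V := by
        rw [← integral_rnDeriv_smul hac]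
        rfl
      have h3 : Integrable (fun z => f z * Real.log (trunc n (f z))) (stat V) :=
        hfi.mul_bdd (hGm n).aestronglyMeasurable
          (Eventually.of_forall fun z => abs_log_trunc_le n (f z))
      have h4 : Integrable (fun z => trunc n (f z) - 1) (stat V) := by
        refine Integrable.sub ?_ (integrable_const _)
        refine Integrable.of_bound ((continuous_trunc n).measurable.comp hfm).aestronglyMeasurable
          ((n : ℝ) + 1) (Eventually.of_forall fun z => ?_)
        rw [Real.norm_eq_abs, abs_of_pos (trunc_pos _ _)]
        exact trunc_le _ _
      simp only [Real.exp_log (trunc_pos n _)] at h1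
      rw [h2, ← integral_sub h3 h4] at h1
      rwa [ofReal_integral_eq_lintegral_ofReal
        (f := fun z => f z * Real.log (trunc n (f z)) - (trunc n (f z) - 1)) (h3.sub h4)
        (Eventually.of_forall fun z => young_trunc_nonneg n (f z))] at h1
    rw [Ent, InformationTheory.klDiv_eq_lintegral_klFun_of_ac hac]
    have hlim : ∀ z, ENNReal.ofReal (InformationTheory.klFun (f z))
        = liminf (fun n => ENNReal.ofReal
          (f z * Real.log (trunc n (f z)) - (trunc n (f z) - 1))) atTop := fun z =>
      (((ENNReal.continuous_ofReal.tendsto _).comp (tendsto_young_trunc (hf0 z))).liminf_eq).symm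
    calc ∫⁻ z, ENNReal.ofReal (InformationTheory.klFun (f z)) ∂stat V
        = ∫⁻ z, liminf (fun n => ENNReal.ofReal
          (f z * Real.log (trunc n (f z)) - (trunc n (f z) - 1))) atTop ∂stat V := by
          simp_rw [hlim]
      _ ≤ liminf (fun n => ∫⁻ z, ENNReal.ofReal
          (f z * Real.log (trunc n (f z)) - (trunc n (f z) - 1)) ∂stat V) atTop := by
          refine lintegral_liminf_le fun n => ENNReal.measurable_ofReal.comp ?_
          exact (hfm.mul (hGm n)).sub (((continuous_trunc n).measurable.comp hfm).sub_const 1)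
      _ ≤ c := liminf_le_of_le (by isBoundedDefault) fun b hb => by
          obtain ⟨n, hn⟩ := hb.exists
          exact hn.trans (hbound n)
  · -- a `π`-null set charged by `μ` supports arbitrarily large test functions at no cost
    have hex : ∃ N, MeasurableSet N ∧ stat V N = 0 ∧ (μ : Measure (Omega V)) N ≠ 0 := by
      by_contra hcon
      push Not at hcon
      exact hac (Measure.AbsolutelyContinuous.mk fun N hN h0 => hcon N hN h0)
    obtain ⟨N, hN, hN0, hN1⟩ := hex
    have hpos : 0 < (μ : Measure (Omega V)).real N :=
      ENNReal.toReal_pos hN1 (measure_ne_top _ _)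
    have hbound : ∀ n : ℕ, ENNReal.ofReal (n * (μ : Measure (Omega V)).real N) ≤ c := fun n => by
      have h1 := ofReal_entropy_dual_le μ h (G := N.indicator fun _ => (n : ℝ))
        (measurable_const.indicator hN) (M := n) fun z => by
          by_cases hz : z ∈ N <;> simp [hz]
      have h2 : ∫ z, (Real.exp (N.indicator (fun _ => (n : ℝ)) z) - 1) ∂stat V = 0 := by
        refine integral_eq_zero_of_ae ?_
        filter_upwards [compl_mem_ae_iff.2 hN0] with z hz
        rw [indicator_of_notMem hz]
        simp
      rw [h2, integral_indicator_const _ hN, sub_zero, smul_eq_mul, mul_comm] at h1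
      exact h1
    have htop : c = ∞ := by
      have hlim : Tendsto (fun n : ℕ => ENNReal.ofReal (n * (μ : Measure (Omega V)).real N)) atTop
          (𝓝 ∞) := ENNReal.tendsto_ofReal_nhds_top.2
        (tendsto_natCast_atTop_atTop.atTop_mul_const hpos)
      exact top_le_iff.1 (le_of_tendsto hlim (Eventually.of_forall hbound))
    rw [htop]
    exact le_top

/-! ### Dual bound for the Fisher information and removal of the mollification -/

theorem integral_eq_half_add_comp_iota {F : Omega V → ℝ} (hF : Integrable F (stat V)) :
    ∫ z, F z ∂stat V = ∫ z, 2⁻¹ * (F z + F (iota z)) ∂stat V := by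
  have h : Integrable (fun z => F (iota z)) (stat V) :=
    (measurePreserving_iota.integrable_comp_emb measurableEmbedding_iota).2 hF
  rw [integral_const_mul, integral_add hF h, integral_comp_iota]
  ring

/-- The duality bound for bounded measurable test functions follows from the one for continuous test
functions. -/
theorem ofReal_fisher_dual_le (μ : ProbabilityMeasure (Omega V)) {c : ℝ≥0∞}
    (h : ∀ g : Omega V → ℝ, Continuous g →
      ENNReal.ofReal (∫ z, (1 - Real.exp (2⁻¹ * dv g z)) ∂(μ : Measure (Omega V))) ≤ c)
    {G : Omega V → ℝ} (hG : Measurable G) {M : ℝ} (hM : ∀ z, |G z| ≤ M) :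
    ENNReal.ofReal (∫ z, (1 - Real.exp (2⁻¹ * dv G z)) ∂(μ : Measure (Omega V))) ≤ c := by
  have hιm : Measurable (iota (V := V)) := continuous_iota.measurable
  obtain ⟨g, hgc, hgM, hg⟩ := exists_continuous_tendsto_ae
    ((μ : Measure (Omega V)) + (μ : Measure (Omega V)).map iota) hG hM
  rw [ae_add_measure_iff] at hg
  have hg2 := ae_of_ae_map hιm.aemeasurable hg.2
  have h1 : Tendsto (fun n => ∫ z, (1 - Real.exp (2⁻¹ * dv (g n) z)) ∂(μ : Measure (Omega V)))
      atTop (𝓝 (∫ z, (1 - Real.exp (2⁻¹ * dv G z)) ∂(μ : Measure (Omega V)))) := by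
    refine tendsto_integral_of_dominated_convergence (fun _ => 1 + Real.exp M)
      (fun n => Continuous.aestronglyMeasurable (by have := continuous_dv (hgc n); fun_prop))
      (integrable_const _) (fun n => Eventually.of_forall fun z => ?_) ?_
    · refine (norm_sub_le _ _).trans ?_
      rw [Real.norm_eq_abs, Real.norm_eq_abs, Real.abs_exp, abs_one]
      refine add_le_add_right (Real.exp_le_exp.2 ?_) 1
      have h2 := (abs_le.1 (hgM n (iota z))).2
      have h3 := (abs_le.1 (hgM n z)).1
      unfold dv
      linarith
    · filter_upwards [hg.1, hg2] with z hz1 hz2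
      exact tendsto_const_nhds.sub ((Real.continuous_exp.tendsto _).comp
        ((hz2.sub hz1).const_mul _))
  exact le_of_tendsto ((ENNReal.continuous_ofReal.tendsto _).comp h1)
    (Eventually.of_forall fun n => h (g n) (hgc n))

/-- The symmetrized integrand of the dual Fisher information at the truncated optimal test
function. -/
def fisherTrunc (n : ℕ) (a b : ℝ) : ℝ :=
  (√(trunc n b) - √(trunc n a)) * (b / √(trunc n b) - a / √(trunc n a))

theorem sqrt_trunc_pos (n : ℕ) (a : ℝ) : 0 < √(trunc n a) := Real.sqrt_pos.2 (trunc_pos n a)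

theorem fisherTrunc_comm (n : ℕ) (a b : ℝ) : fisherTrunc n a b = fisherTrunc n b a := by
  unfold fisherTrunc; ring

theorem fisherTrunc_nonneg (n : ℕ) {a b : ℝ} (ha : 0 ≤ a) (hb : 0 ≤ b) :
    0 ≤ fisherTrunc n a b := by
  wlog hab : a ≤ b generalizing a b
  · rw [fisherTrunc_comm]
    exact this hb ha (le_of_not_ge hab)
  refine mul_nonneg (sub_nonneg.2 (Real.sqrt_le_sqrt (trunc_mono n hab))) (sub_nonneg.2 ?_)
  rw [div_le_div_iff₀ (sqrt_trunc_pos n a) (sqrt_trunc_pos n b)]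
  refine le_of_sq_le_sq ?_ (mul_nonneg hb (Real.sqrt_nonneg _))
  rw [mul_pow, mul_pow, Real.sq_sqrt (trunc_pos n b).le, Real.sq_sqrt (trunc_pos n a).le]
  have h1 := mul_trunc_le n ha hab
  have h2 := mul_le_mul_of_nonneg_left h1 hb
  have h3 := mul_le_mul_of_nonneg_right hab (mul_nonneg ha (trunc_pos n b).le)
  nlinarith

theorem tendsto_fisherTrunc {a b : ℝ} (ha : 0 ≤ a) (hb : 0 ≤ b) :
    Tendsto (fun n => fisherTrunc n a b) atTop (𝓝 ((√b - √a) ^ 2)) := by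
  have h1 : ∀ {s : ℝ}, 0 ≤ s → Tendsto (fun n => √(trunc n s)) atTop (𝓝 √s) := fun hs =>
    (Real.continuous_sqrt.tendsto _).comp (tendsto_trunc hs)
  have h2 : ∀ {s : ℝ}, 0 ≤ s → Tendsto (fun n => s / √(trunc n s)) atTop (𝓝 √s) := fun {s} hs => by
    rcases hs.eq_or_lt with rfl | hs
    · simp
    · have h3 := (tendsto_const_nhds (x := s)).div (h1 hs.le) (Real.sqrt_pos.2 hs).ne'
      rwa [Real.div_sqrt] at h3
  rw [sq]
  exact ((h1 hb).sub (h1 ha)).mul ((h2 hb).sub (h2 ha))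

theorem exp_half_log_sub {a b : ℝ} (ha : 0 < a) (hb : 0 < b) :
    Real.exp (2⁻¹ * (Real.log b - Real.log a)) = √b / √a := by
  rw [mul_sub, Real.exp_sub, exp_half_log ha, exp_half_log hb]

/-- Dual characterization of the Fisher information: it is dominated by every bound on
`∫ (1 - exp (½ (g ∘ ι - g))) dμ` that is uniform over continuous `g`. -/
theorem FI_le_of_forall (μ : ProbabilityMeasure (Omega V))
    (hac : (μ : Measure (Omega V)) ≪ stat V) {c : ℝ≥0∞}
    (h : ∀ g : Omega V → ℝ, Continuous g →
      ENNReal.ofReal (∫ z, (1 - Real.exp (2⁻¹ * dv g z)) ∂(μ : Measure (Omega V))) ≤ c) :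
    FI μ ≤ c := by
  set f : Omega V → ℝ := fun z => ((μ : Measure (Omega V)).rnDeriv (stat V) z).toReal with hf
  have hfm : Measurable f := (Measure.measurable_rnDeriv _ _).ennreal_toReal
  have hfi : Integrable f (stat V) := Measure.integrable_toReal_rnDeriv
  have hf0 : ∀ z, 0 ≤ f z := fun z => ENNReal.toReal_nonneg
  have hιm : Measurable (iota (V := V)) := continuous_iota.measurable
  have hGm : ∀ n, Measurable fun z => Real.log (trunc n (f z)) := fun n =>
    Real.measurable_log.comp ((continuous_trunc n).measurable.comp hfm)
  have hsm : ∀ n, Measurable fun z => √(trunc n (f z)) := fun n =>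
    Real.continuous_sqrt.measurable.comp ((continuous_trunc n).measurable.comp hfm)
  have hFm : ∀ n, Measurable fun z => fisherTrunc n (f z) (f (iota z)) := fun n => by
    unfold fisherTrunc
    exact (((hsm n).comp hιm).sub (hsm n)).mul
      (((hfm.comp hιm).div ((hsm n).comp hιm)).sub (hfm.div (hsm n)))
  have hbound : ∀ n, 2⁻¹ * ∫⁻ z, ENNReal.ofReal (fisherTrunc n (f z) (f (iota z))) ∂stat V
      ≤ c := fun n => by
    have h1 := ofReal_fisher_dual_le μ h (hGm n) (fun z => abs_log_trunc_le n (f z))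
    set G : Omega V → ℝ := fun z => Real.log (trunc n (f z)) with hG
    have hGdm : Measurable fun z => 1 - Real.exp (2⁻¹ * dv G z) :=
      measurable_const.sub (Real.measurable_exp.comp
        ((((hGm n).comp hιm).sub (hGm n)).const_mul _))
    have h2 : ∫ z, (1 - Real.exp (2⁻¹ * dv G z)) ∂(μ : Measure (Omega V))
        = ∫ z, f z * (1 - Real.exp (2⁻¹ * dv G z)) ∂stat V := by
      rw [← integral_rnDeriv_smul hac]
      rfl
    have h3 : Integrable (fun z => f z * (1 - Real.exp (2⁻¹ * dv G z))) (stat V) := by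
      refine hfi.mul_bdd (c := 1 + Real.exp (Real.log ((n : ℝ) + 1))) hGdm.aestronglyMeasurable
        (Eventually.of_forall fun z => ?_)
      refine (norm_sub_le _ _).trans ?_
      rw [Real.norm_eq_abs, Real.norm_eq_abs, Real.abs_exp, abs_one]
      refine add_le_add_right (Real.exp_le_exp.2 ?_) 1
      have h4 := (abs_le.1 (abs_log_trunc_le n (f (iota z)))).2
      have h5 := (abs_le.1 (abs_log_trunc_le n (f z))).1
      simp only [dv, hG]
      linarith
    have h6 : ∀ z, 2⁻¹ * (f z * (1 - Real.exp (2⁻¹ * dv G z))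
        + f (iota z) * (1 - Real.exp (2⁻¹ * dv G (iota z))))
        = 2⁻¹ * fisherTrunc n (f z) (f (iota z)) := fun z => by
      simp only [dv, hG, iota_iota]
      rw [exp_half_log_sub (trunc_pos _ _) (trunc_pos _ _),
        exp_half_log_sub (trunc_pos _ _) (trunc_pos _ _), fisherTrunc]
      have h7 := sqrt_trunc_pos n (f z)
      have h8 := sqrt_trunc_pos n (f (iota z))
      field_simp
      ring
    have h9 : Integrable (fun z => 2⁻¹ * fisherTrunc n (f z) (f (iota z))) (stat V) := by
      simp_rw [← h6]
      exact (h3.add ((measurePreserving_iota.integrable_comp_emb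
        measurableEmbedding_iota).2 h3)).const_mul _
    rw [h2, integral_eq_half_add_comp_iota h3] at h1
    simp_rw [h6] at h1
    rw [ofReal_integral_eq_lintegral_ofReal h9 (Eventually.of_forall fun z =>
      mul_nonneg (by norm_num) (fisherTrunc_nonneg n (hf0 _) (hf0 _)))] at h1
    have h10 : ∀ z, ENNReal.ofReal (2⁻¹ * fisherTrunc n (f z) (f (iota z)))
        = 2⁻¹ * ENNReal.ofReal (fisherTrunc n (f z) (f (iota z))) := fun z => by
      rw [ENNReal.ofReal_mul (by norm_num), ENNReal.ofReal_inv_of_pos two_pos]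
      simp
    simp_rw [h10] at h1
    rwa [lintegral_const_mul _ (hFm n).ennreal_ofReal] at h1
  have hlim : ∀ z, ENNReal.ofReal ((√(f (iota z)) - √(f z)) ^ 2)
      = liminf (fun n => ENNReal.ofReal (fisherTrunc n (f z) (f (iota z)))) atTop := fun z =>
    (((ENNReal.continuous_ofReal.tendsto _).comp
      (tendsto_fisherTrunc (hf0 z) (hf0 (iota z)))).liminf_eq).symm
  rw [FI, if_pos hac]
  have hfatou : ∫⁻ z, ENNReal.ofReal ((√(f (iota z)) - √(f z)) ^ 2) ∂stat V
      ≤ liminf (fun n => ∫⁻ z, ENNReal.ofReal (fisherTrunc n (f z) (f (iota z))) ∂stat V)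
        atTop := by
    simp_rw [hlim]
    exact lintegral_liminf_le fun n => ENNReal.measurable_ofReal.comp (hFm n)
  have hle : ∫⁻ z, ENNReal.ofReal ((√(f (iota z)) - √(f z)) ^ 2) ∂stat V ≤ 2 * c := by
    refine hfatou.trans (liminf_le_of_le (by isBoundedDefault) fun b hb => ?_)
    obtain ⟨n, hn⟩ := hb.exists
    refine hn.trans ?_
    rw [← ENNReal.inv_mul_le_iff two_ne_zero (by simp)]
    exact hbound n
  rw [ENNReal.inv_mul_le_iff two_ne_zero (by simp)]
  exact hle

namespace Mollifier

theorem integral_smooth_sub_le_entropy (K : Mollifier V) (μ : ProbabilityMeasure (Omega V))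
    {g : Omega V → ℝ} (hg : Continuous g) :
    (∫ w, K.smooth g w ∂(μ : Measure (Omega V))) - ∫ z, (Real.exp (g z) - 1) ∂stat V
      ≤ K.entropy μ := by
  have c := K.continuous_density μ
  have ck := InformationTheory.continuous_klFun
  rw [← integral_mul_dens K.continuous_ker hg, ← integral_sub
    (Continuous.integrable_of_compact (by fun_prop) _)
    (Continuous.integrable_of_compact (by fun_prop) _)]
  refine integral_mono (Continuous.integrable_of_compact (by fun_prop) _)
    (Continuous.integrable_of_compact (by fun_prop) _) fun z => ?_
  have ha := K.density_pos μ z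
  have h1 : K.density μ z * (g z - Real.log (K.density μ z) + 1) ≤ Real.exp (g z) := by
    have h2 := mul_le_mul_of_nonneg_left
      (Real.add_one_le_exp (g z - Real.log (K.density μ z))) ha.le
    rwa [Real.exp_sub, Real.exp_log ha, mul_div_cancel₀ _ ha.ne'] at h2
  simp only [InformationTheory.klFun]
  simp only [density] at h1 ⊢
  linarith

theorem integral_smooth_le_fisher (K : Mollifier V) (μ : ProbabilityMeasure (Omega V))
    {g : Omega V → ℝ} (hg : Continuous g) :
    ∫ w, K.smooth (fun z => 1 - Real.exp (2⁻¹ * dv g z)) w ∂(μ : Measure (Omega V))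
      ≤ K.fisher μ := by
  have c := K.continuous_density μ
  have cd := continuous_dv hg
  rw [← integral_mul_dens K.continuous_ker (by fun_prop), integral_eq_half_add_comp_iota
    (Continuous.integrable_of_compact (by fun_prop) _), fisher, ← integral_const_mul]
  refine integral_mono (Continuous.integrable_of_compact (by fun_prop) _)
    (Continuous.integrable_of_compact (by fun_prop) _) fun z => ?_
  refine mul_le_mul_of_nonneg_left ?_ (by norm_num)
  have hflip : dv g (iota z) = -dv g z := by simp only [dv, iota_iota]; ring
  -- AM-GM, with `p² = exp (½ (g ∘ ι - g))`
  set p := Real.exp (4⁻¹ * dv g z) with hp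
  have hp0 : 0 < p := Real.exp_pos _
  have h1 : Real.exp (2⁻¹ * dv g z) = p * p := by rw [hp, ← Real.exp_add]; ring_nf
  have h2 : Real.exp (2⁻¹ * dv g (iota z)) = p⁻¹ * p⁻¹ := by
    rw [hflip, hp, ← Real.exp_neg, ← Real.exp_add]; ring_nf
  have h3 := Real.sq_sqrt (K.density_pos μ z).le
  have h4 := Real.sq_sqrt (K.density_pos μ (iota z)).le
  have h5 := mul_inv_cancel₀ hp0.ne'
  simp only [h1, h2]
  simp only [density] at h3 h4 ⊢
  set x := √(dens K.ker (μ : Measure (Omega V)) z)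
  set y := √(dens K.ker (μ : Measure (Omega V)) (iota z))
  rw [← h3, ← h4]
  have h6 : 0 ≤ (p * x - p⁻¹ * y) ^ 2 := sq_nonneg _
  have h7 : (p * x - p⁻¹ * y) ^ 2
      = p * p * x ^ 2 + p⁻¹ * p⁻¹ * y ^ 2 - 2 * (p * p⁻¹) * (x * y) := by ring
  rw [h5] at h7
  linarith

/-- Mollification does not increase the entropy. -/
theorem ofReal_entropy_le (K : Mollifier V) (μ : ProbabilityMeasure (Omega V)) :
    ENNReal.ofReal (K.entropy μ) ≤ Ent (μ : Measure (Omega V)) (stat V) := by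
  by_cases htop : Ent (μ : Measure (Omega V)) (stat V) = ∞
  · rw [htop]; exact le_top
  obtain ⟨hac, hint⟩ := InformationTheory.klDiv_ne_top_iff.1 htop
  rw [← ENNReal.ofReal_toReal htop, Ent, InformationTheory.toReal_klDiv_eq_integral_klFun hac]
  refine ENNReal.ofReal_le_ofReal ?_
  have c := K.continuous_density μ
  -- the logarithm of the mollified density is the optimal test function for its entropy
  set g : Omega V → ℝ := fun z => Real.log (K.density μ z) with hg
  have hgc : Continuous g := c.log fun z => (K.density_pos μ z).ne'
  have hsc : Continuous (K.smooth g) := continuous_adj K.continuous_ker hgc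
  set f : Omega V → ℝ := fun z => ((μ : Measure (Omega V)).rnDeriv (stat V) z).toReal with hf
  have hfi : Integrable f (stat V) := Measure.integrable_toReal_rnDeriv
  have h1 : K.entropy μ = ∫ w, K.smooth g w ∂(μ : Measure (Omega V)) := by
    rw [← integral_mul_dens K.continuous_ker hgc]
    have h2 : ∀ z, InformationTheory.klFun (K.density μ z)
        = g z * K.density μ z + (1 - K.density μ z) := fun z => by
      rw [InformationTheory.klFun, hg]; ring
    unfold entropy
    simp_rw [h2]
    rw [integral_add (Continuous.integrable_of_compact (by fun_prop) _)
      (Continuous.integrable_of_compact (by fun_prop) _),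
      integral_sub (integrable_const _) (Continuous.integrable_of_compact (by fun_prop) _),
      K.integral_density]
    simp
  have h3 : ∫ w, K.smooth g w ∂(μ : Measure (Omega V))
      = ∫ z, f z * K.smooth g z ∂stat V := by
    rw [← integral_rnDeriv_smul hac]; rfl
  have h4 : ∫ z, Real.exp (K.smooth g z) ∂stat V ≤ 1 := by
    calc ∫ z, Real.exp (K.smooth g z) ∂stat V
        ≤ ∫ z, K.smooth (fun z => Real.exp (g z)) z ∂stat V :=
          integral_mono (Continuous.integrable_of_compact (by fun_prop) _)
            ((continuous_adj K.continuous_ker (by fun_prop)).integrable_of_compact _)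
            fun w => K.exp_smooth_le hgc w
      _ = 1 := by
          rw [K.integral_smooth (by fun_prop)]
          simp only [hg, Real.exp_log (K.density_pos μ _)]
          exact K.integral_density μ
  obtain ⟨C, hC⟩ := isCompact_univ.exists_bound_of_continuousOn hsc.continuousOn
  have hi1 : Integrable (fun z => f z * K.smooth g z) (stat V) :=
    hfi.mul_bdd hsc.aestronglyMeasurable (Eventually.of_forall fun z => hC z (mem_univ z))
  have hi2 : Integrable (fun z => Real.exp (K.smooth g z) - 1) (stat V) :=
    Continuous.integrable_of_compact (by fun_prop) _
  have h5 : ∫ z, (f z * K.smooth g z - (Real.exp (K.smooth g z) - 1)) ∂stat V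
      ≤ ∫ z, InformationTheory.klFun (f z) ∂stat V := by
    refine integral_mono (hi1.sub hi2)
      ((InformationTheory.integrable_klFun_rnDeriv_iff hac).2 hint) fun z => ?_
    have hf0 : 0 ≤ f z := ENNReal.toReal_nonneg
    simp only [InformationTheory.klFun]
    rcases hf0.eq_or_lt with h0 | h0
    · rw [← h0]
      linarith [Real.exp_pos (K.smooth g z)]
    · have h2 := mul_le_mul_of_nonneg_left
        (Real.add_one_le_exp (K.smooth g z - Real.log (f z))) h0.le
      rw [Real.exp_sub, Real.exp_log h0, mul_div_cancel₀ _ h0.ne'] at h2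
      linarith
  rw [integral_sub hi1 hi2, integral_sub (Continuous.integrable_of_compact (by fun_prop) _)
    (integrable_const _)] at h5
  simp only [integral_const, probReal_univ, smul_eq_mul, mul_one] at h5
  rw [h1, h3]
  linarith

/-- The integrals of mollified test functions converge. -/
theorem tendsto_integral_smooth {K : ℕ → Mollifier V} {g : Omega V → ℝ} (hg : Continuous g)
    (hK : ∀ w, Tendsto (fun n => (K n).smooth g w) atTop (𝓝 (g w)))
    (μ : ProbabilityMeasure (Omega V)) :
    Tendsto (fun n => ∫ w, (K n).smooth g w ∂(μ : Measure (Omega V))) atTop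
      (𝓝 (∫ w, g w ∂(μ : Measure (Omega V)))) := by
  obtain ⟨C, hC⟩ := isCompact_univ.exists_bound_of_continuousOn hg.continuousOn
  refine tendsto_integral_of_dominated_convergence (fun _ => C)
    (fun n => (continuous_adj (K n).continuous_ker hg).aestronglyMeasurable) (integrable_const _)
    (fun n => Eventually.of_forall fun w => ?_) (Eventually.of_forall hK)
  have h1 := fun z => abs_le.1 (hC z (mem_univ z))
  refine abs_le.2 ⟨?_, ?_⟩
  · have h2 := (K n).smooth_mono continuous_const hg (fun z => (h1 z).1) w
    rwa [smooth_const] at h2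
  · have h2 := (K n).smooth_mono hg continuous_const (fun z => (h1 z).2) w
    rwa [smooth_const] at h2

variable {K : ℕ → Mollifier V}

theorem Ent_le_liminf (hK : ∀ g : Omega V → ℝ, Continuous g →
      ∀ w, Tendsto (fun n => (K n).smooth g w) atTop (𝓝 (g w)))
    (μ : ProbabilityMeasure (Omega V)) :
    Ent (μ : Measure (Omega V)) (stat V)
      ≤ liminf (fun n => ENNReal.ofReal ((K n).entropy μ)) atTop := by
  refine Ent_le_of_forall μ fun g hg => ?_
  have h1 := (ENNReal.continuous_ofReal.tendsto _).comp ((tendsto_integral_smooth hg (hK g hg)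
    μ).sub_const (∫ z, (Real.exp (g z) - 1) ∂stat V))
  rw [← h1.liminf_eq]
  exact liminf_le_liminf (Eventually.of_forall fun n =>
    ENNReal.ofReal_le_ofReal ((K n).integral_smooth_sub_le_entropy μ hg))

theorem FI_le_liminf (hK : ∀ g : Omega V → ℝ, Continuous g →
      ∀ w, Tendsto (fun n => (K n).smooth g w) atTop (𝓝 (g w)))
    (μ : ProbabilityMeasure (Omega V)) (hac : (μ : Measure (Omega V)) ≪ stat V) :
    FI μ ≤ liminf (fun n => ENNReal.ofReal ((K n).fisher μ)) atTop := by
  refine FI_le_of_forall μ hac fun g hg => ?_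
  have hc : Continuous fun z => 1 - Real.exp (2⁻¹ * dv g z) := by
    have := continuous_dv hg
    fun_prop
  have h1 := (ENNReal.continuous_ofReal.tendsto _).comp (tendsto_integral_smooth hc (hK _ hc) μ)
  rw [← h1.liminf_eq]
  exact liminf_le_liminf (Eventually.of_forall fun n =>
    ENNReal.ofReal_le_ofReal ((K n).integral_smooth_le_fisher μ hg))

end Mollifier

/-! ### Hamiltonian bounds for the continuity equation and for weak solutions -/

instance {X : Type*} [MeasurableSpace X] (m : SignedMeasure X) :
    IsFiniteMeasure m.variation := by
  rw [← SignedMeasure.totalVariation_eq_variation, SignedMeasure.totalVariation]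
  infer_instance

/-- Integrals against a setwise measurable family of signed measures are measurable. -/
theorem measurable_integral_signedMeasure {ι X : Type*} [MeasurableSpace ι] [MeasurableSpace X]
    {m : ι → SignedMeasure X} (hm : ∀ B, MeasurableSet B → Measurable fun t => m t B)
    {ψ : X → ℝ} (hψ : Measurable ψ) {C : ℝ} (hC : ∀ z, |ψ z| ≤ C) :
    Measurable fun t => (m t).integral ψ (ContinuousLinearMap.lsmul ℝ ℝ).flip := by
  have hsimple : ∀ f : SimpleFunc X ℝ,
      Measurable fun t => (m t).integral f (ContinuousLinearMap.lsmul ℝ ℝ).flip := by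
    intro f
    induction f using SimpleFunc.induction with
    | @const c s hs =>
      have h0 : ⇑(SimpleFunc.piecewise s hs (SimpleFunc.const X c) (SimpleFunc.const X 0))
          = s.indicator fun _ => c := by
        funext x
        by_cases hx : x ∈ s <;> simp [hx]
      have h : ∀ t, (m t).integral (s.indicator fun _ => c)
          (ContinuousLinearMap.lsmul ℝ ℝ).flip = m t s * c := fun t => by
        rw [VectorMeasure.integral_indicator hs, VectorMeasure.integral_const,
          VectorMeasure.restrict_apply _ hs MeasurableSet.univ]
        simp
      rw [h0]
      simp_rw [h]
      exact (hm s hs).mul_const c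
    | @add f g hfg hf hg =>
      have h : ∀ t, (m t).integral (⇑f + ⇑g) (ContinuousLinearMap.lsmul ℝ ℝ).flip
          = (m t).integral f (ContinuousLinearMap.lsmul ℝ ℝ).flip
            + (m t).integral g (ContinuousLinearMap.lsmul ℝ ℝ).flip := fun t =>
        VectorMeasure.integral_add f.integrable_of_isFiniteMeasure
          g.integrable_of_isFiniteMeasure
      rw [SimpleFunc.coe_add]
      simp_rw [h]
      exact hf.add hg
  rcases isEmpty_or_nonempty X with hX | ⟨⟨z₀⟩⟩
  · simp only [VectorMeasure.integral_of_isEmpty]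
    exact measurable_const
  have hC0 : 0 ≤ C := (abs_nonneg _).trans (hC z₀)
  have hs := hψ.stronglyMeasurable
  refine measurable_of_tendsto_metrizable (fun n => hsimple (hs.approxBounded C n))
    (tendsto_pi_nhds.2 fun t => ?_)
  exact VectorMeasure.tendsto_integral_of_dominated_convergence (fun _ => C)
    (fun n => (hs.approxBounded C n).aestronglyMeasurable) (integrable_const _)
    (fun n => Eventually.of_forall fun z => hs.norm_approxBounded_le hC0 n z)
    (Eventually.of_forall fun z => hs.tendsto_approxBounded_of_norm_le (hC z))

theorem pairing_neg (φ₁ φ₂ : Omega V → ℝ) (j : Flux V) :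
    pairing (-φ₁) (-φ₂) j = -pairing φ₁ φ₂ j := by
  unfold pairing
  rw [VectorMeasure.integral_neg, VectorMeasure.integral_neg]
  ring

theorem ofReal_le_lagrangian (lam : ℝ) (μ : ProbabilityMeasure (Omega V)) (j : Flux V)
    {φ₁ φ₂ : Omega V → ℝ} (h₁ : Continuous φ₁) (h₂ : Continuous φ₂) :
    ENNReal.ofReal (pairing φ₁ φ₂ j - hamiltonian lam μ φ₁ φ₂) ≤ lagrangian lam μ j :=
  le_iSup₂ (f := fun (φ₁ : C(Omega V, ℝ)) (φ₂ : C(Omega V, ℝ)) =>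
    ENNReal.ofReal (pairing φ₁ φ₂ j - hamiltonian lam μ φ₁ φ₂)) ⟨φ₁, h₁⟩ ⟨φ₂, h₂⟩

theorem continuousOn_hamiltonian (lam : ℝ) {σ : ℝ → ProbabilityMeasure (Omega V)} {s : Set ℝ}
    (hσ : ContinuousOn σ s) {φ₁ φ₂ : Omega V → ℝ} (h₁ : Continuous φ₁) (h₂ : Continuous φ₂) :
    ContinuousOn (fun r => hamiltonian lam (σ r) φ₁ φ₂) s := by
  rw [continuousOn_iff_continuous_domRestrict] at hσ ⊢
  exact continuous_hamiltonian lam hσ h₁ h₂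

theorem CE.aestronglyMeasurable_pairing {T : ℝ} {σ : ℝ → ProbabilityMeasure (Omega V)}
    {j : ℝ → Flux V} (h : CE T σ j) {φ₁ φ₂ : Omega V → ℝ} (h₁ : Continuous φ₁)
    (h₂ : Continuous φ₂) :
    AEStronglyMeasurable (fun r => pairing φ₁ φ₂ (j r)) (volume.restrict (Ioo 0 T)) := by
  obtain ⟨C₁, hC₁⟩ := isCompact_univ.exists_bound_of_continuousOn h₁.continuousOn
  obtain ⟨C₂, hC₂⟩ := isCompact_univ.exists_bound_of_continuousOn h₂.continuousOn
  refine (aemeasurable_restrict_of_measurable_subtype measurableSet_Ioo ?_).aestronglyMeasurable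
  exact (measurable_integral_signedMeasure (m := fun t : Ioo (0 : ℝ) T => (j t).1)
    h.measurable_fst h₁.measurable fun z => hC₁ z (mem_univ z)).add
    (measurable_integral_signedMeasure (m := fun t : Ioo (0 : ℝ) T => (j t).2)
    h.measurable_snd h₂.measurable fun z => hC₂ z (mem_univ z))

/-- Along a solution of the continuity equation with finite action, the growth of test functions is
controlled by the Hamiltonian up to the accumulated Lagrangian. The Lagrangian is not known to be
measurable in time, so the estimates compare lower integrals of measurable minorants with it. -/
theorem CE.hamiltonianBound {lam T : ℝ} {σ : ℝ → ProbabilityMeasure (Omega V)} {j : ℝ → Flux V}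
    (h : CE T σ j) (hfin : ∫⁻ r in Ioo 0 T, lagrangian lam (σ r) (j r) ≠ ∞) :
    HamiltonianBound lam σ (fun t => (∫⁻ r in Ioo 0 t, lagrangian lam (σ r) (j r)).toReal) 0 T := by
  intro φ hφ hc hdx s t hs hst ht
  set L : ℝ → ℝ≥0∞ := fun r => lagrangian lam (σ r) (j r) with hL
  have hdv := continuous_dv hc
  have hsub : Ioo s t ⊆ Ioo 0 T := Ioo_subset_Ioo hs ht
  have hsubIcc : Ioo s t ⊆ Icc 0 T := hsub.trans Ioo_subset_Icc_self
  have hLst : ∫⁻ r in Ioo s t, L r ≠ ∞ := ne_top_of_le_ne_top hfin (lintegral_mono_set hsub)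
  set p : ℝ → ℝ := fun r => pairing (dx φ) (dv φ) (j r) with hp
  set k : ℝ → ℝ := fun r => hamiltonian lam (σ r) (dx φ) (dv φ) with hk
  set k' : ℝ → ℝ := fun r => hamiltonian lam (σ r) (-dx φ) (-dv φ) with hk'
  have hki : IntegrableOn k (Ioo s t) :=
    ((continuousOn_hamiltonian lam h.continuousOn hdx hdv).integrableOn_Icc).mono_set hsubIcc
  have hki' : IntegrableOn k' (Ioo s t) :=
    ((continuousOn_hamiltonian lam h.continuousOn hdx.neg hdv.neg).integrableOn_Icc).mono_set
      hsubIcc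
  have hpm : AEStronglyMeasurable p (volume.restrict (Ioo s t)) :=
    (h.aestronglyMeasurable_pairing hdx hdv).mono_measure (Measure.restrict_mono hsub le_rfl)
  have hle : ∀ r, ENNReal.ofReal (p r - k r) ≤ L r := fun r =>
    ofReal_le_lagrangian lam _ _ hdx hdv
  have hle' : ∀ r, ENNReal.ofReal (-p r - k' r) ≤ L r := fun r => by
    rw [hp, ← pairing_neg]
    exact ofReal_le_lagrangian lam _ _ hdx.neg hdv.neg
  have hpi : IntegrableOn p (Ioo s t) := by
    refine ⟨hpm, ?_⟩
    have h1 : ∀ r, ‖p r‖ₑ ≤ L r + ENNReal.ofReal (|k r| + |k' r|) := fun r => by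
      rw [Real.enorm_eq_ofReal_abs]
      rcases abs_choice (p r) with h2 | h2
      · refine le_trans ?_ (add_le_add_left (hle r) _)
        refine le_trans (ENNReal.ofReal_le_ofReal ?_) ENNReal.ofReal_add_le
        linarith [le_abs_self (k r), abs_nonneg (k' r)]
      · refine le_trans ?_ (add_le_add_left (hle' r) _)
        refine le_trans (ENNReal.ofReal_le_ofReal ?_) ENNReal.ofReal_add_le
        linarith [le_abs_self (k' r), abs_nonneg (k r)]
    have h2 : Integrable (fun r => |k r| + |k' r|) (volume.restrict (Ioo s t)) :=
      hki.abs.add hki'.abs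
    refine (lintegral_mono h1).trans_lt ?_
    rw [lintegral_add_right' _ h2.aestronglyMeasurable.aemeasurable.ennreal_ofReal]
    exact ENNReal.add_lt_top.2 ⟨hLst.lt_top, h2.lintegral_lt_top⟩
  have hint : ∀ f : ℝ → ℝ, ∫ r in s..t, f r = ∫ r in Ioo s t, f r := fun f => by
    rw [intervalIntegral.integral_of_le hst, integral_Ioc_eq_integral_Ioo]
  have hqi : IntegrableOn (fun r => p r - k r) (Ioo s t) := hpi.sub hki
  have hmain : ∫ r in Ioo s t, (p r - k r) ≤ (∫⁻ r in Ioo s t, L r).toReal := by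
    rw [integral_eq_lintegral_pos_part_sub_lintegral_neg_part hqi]
    refine (sub_le_self _ ENNReal.toReal_nonneg).trans ?_
    exact ENNReal.toReal_mono hLst (lintegral_mono hle)
  have hA : (∫⁻ r in Ioo 0 s, L r).toReal + (∫⁻ r in Ioo s t, L r).toReal
      ≤ (∫⁻ r in Ioo 0 t, L r).toReal := by
    have h1 : ∫⁻ r in Ioo 0 t, L r ≠ ∞ :=
      ne_top_of_le_ne_top hfin (lintegral_mono_set (Ioo_subset_Ioo le_rfl ht))
    have h2 : ∫⁻ r in Ioo 0 s, L r ≠ ∞ :=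
      ne_top_of_le_ne_top h1 (lintegral_mono_set (Ioo_subset_Ioo le_rfl hst))
    rw [← ENNReal.toReal_add h2 hLst]
    refine ENNReal.toReal_mono h1 ?_
    have hdisj : Disjoint (Ioo 0 s) (Ioo s t) :=
      Set.disjoint_left.2 fun x hx hx' => lt_asymm hx.2 hx'.1
    rw [← lintegral_union measurableSet_Ioo hdisj]
    exact lintegral_mono_set (union_subset (Ioo_subset_Ioo le_rfl hst)
      (Ioo_subset_Ioo hs le_rfl))
  rw [h.weak φ hφ s t hs hst ht, hint, hint]
  rw [integral_sub hpi hki] at hmain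
  simp only
  linarith

/-- For weak solutions of the Kac equation the Hamiltonian bound holds at no cost. -/
theorem IsWeakSolution.hamiltonianBound {lam T : ℝ} (hlam : 0 ≤ lam)
    {σ₀ : ProbabilityMeasure (Omega V)} {σ : ℝ → ProbabilityMeasure (Omega V)}
    (h : IsWeakSolution lam T σ₀ σ) : HamiltonianBound lam σ (fun _ => 0) 0 T := by
  intro φ hφ hc hdx s t hs hst ht
  have hdv := continuous_dv hc
  have hgen : Continuous (generator lam φ) := by
    unfold generator; fun_prop
  have hsub : Icc s t ⊆ Icc 0 T := Icc_subset_Icc hs ht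
  have hσ := h.continuousOn.mono hsub
  rw [h.weak φ hφ s t hs hst ht, sub_zero, zero_add]
  refine intervalIntegral.integral_mono_on hst ?_ ?_ fun r _ => ?_
  · refine ContinuousOn.intervalIntegrable_of_Icc hst ?_
    rw [continuousOn_iff_continuous_domRestrict] at hσ ⊢
    exact continuous_integral_of_continuous hσ (g := fun _ z => generator lam φ z) (by fun_prop)
  · exact (continuousOn_hamiltonian lam hσ hdx hdv).intervalIntegrable_of_Icc hst
  · refine integral_mono (hgen.integrable_of_compact _)
      (Continuous.integrable_of_compact (by fun_prop) _) fun z => ?_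
    have h1 : φ (iota z) - φ z ≤ Real.exp (dv φ z) - 1 := by
      have := Real.add_one_le_exp (dv φ z)
      unfold dv at this ⊢
      linarith
    exact add_le_add_right (mul_le_mul_of_nonneg_left h1 hlam) _

theorem HamiltonianBound.mono {lam : ℝ} {σ : ℝ → ProbabilityMeasure (Omega V)} {A : ℝ → ℝ}
    {a b a' b' : ℝ} (h : HamiltonianBound lam σ A a b) (ha : a ≤ a') (hb : b' ≤ b) :
    HamiltonianBound lam σ A a' b' := fun φ h1 h2 h3 s t hs hst ht =>
  h φ h1 h2 h3 s t (ha.trans hs) hst (ht.trans hb)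

theorem HamiltonianBound.congr {lam : ℝ} {σ σ' : ℝ → ProbabilityMeasure (Omega V)} {A : ℝ → ℝ}
    {a b : ℝ} (h : HamiltonianBound lam σ A a b) (hσ : EqOn σ' σ (Icc a b)) :
    HamiltonianBound lam σ' A a b := fun φ h1 h2 h3 s t hs hst ht => by
  have h4 := h φ h1 h2 h3 s t hs hst ht
  rw [hσ ⟨hs.trans hst, ht⟩, hσ ⟨hs, hst.trans ht⟩]
  refine h4.trans (le_of_eq ?_)
  congr 1
  refine intervalIntegral.integral_congr fun r hr => ?_
  rw [uIcc_of_le hst] at hr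
  simp only [hσ ⟨hs.trans hr.1, hr.2.trans ht⟩]

theorem mul_liminf_add_mul_liminf_le {u v : ℕ → ℝ≥0∞} {c d R : ℝ≥0∞}
    (h : ∀ n, c * u n + d * v n ≤ R) : c * liminf u atTop + d * liminf v atTop ≤ R := by
  rw [liminf_eq_iSup_iInf_of_nat, liminf_eq_iSup_iInf_of_nat, ENNReal.mul_iSup, ENNReal.mul_iSup,
    ENNReal.iSup_add_iSup_of_monotone]
  · exact iSup_le fun n => (add_le_add (mul_le_mul_right (iInf₂_le n le_rfl) _)
      (mul_le_mul_right (iInf₂_le n le_rfl) _)).trans (h n)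
  · exact fun n m hnm => mul_le_mul_right
      (biInf_mono fun i hi => hnm.trans hi) _
  · exact fun n m hnm => mul_le_mul_right
      (biInf_mono fun i hi => hnm.trans hi) _

/-- The entropy inequality at the mollified level, in extended nonnegative reals. -/
theorem Mollifier.ofReal_entropy_add_fisher_le (K : Mollifier V) {lam : ℝ} (hlam : 0 ≤ lam)
    {σ : ℝ → ProbabilityMeasure (Omega V)} (hσ : Continuous σ) {A : ℝ → ℝ} {a b : ℝ}
    (hab : a ≤ b) (H : HamiltonianBound lam σ A a b) :
    2⁻¹ * ENNReal.ofReal (K.entropy (σ b))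
        + ENNReal.ofReal lam * ∫⁻ r in Ioo a b, ENNReal.ofReal (K.fisher (σ r))
      ≤ 2⁻¹ * Ent (σ a : Measure (Omega V)) (stat V) + ENNReal.ofReal (A b - A a) := by
  have h1 := K.entropy_add_fisher_le hlam hσ hab H
  have hf : ∫⁻ r in Ioo a b, ENNReal.ofReal (K.fisher (σ r))
      = ENNReal.ofReal (∫ r in a..b, K.fisher (σ r)) := by
    rw [intervalIntegral.integral_of_le hab, integral_Ioc_eq_integral_Ioo,
      ofReal_integral_eq_lintegral_ofReal _ (Eventually.of_forall fun r => K.fisher_nonneg _)]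
    exact ((K.continuous_fisher hσ).integrableOn_Icc (a := a) (b := b)).mono_set
      Ioo_subset_Icc_self
  have h2 : ∀ x : ℝ, 2⁻¹ * ENNReal.ofReal x = ENNReal.ofReal (2⁻¹ * x) := fun x => by
    rw [ENNReal.ofReal_mul (by norm_num), ENNReal.ofReal_inv_of_pos two_pos]
    simp
  have hI : 0 ≤ ∫ r in a..b, K.fisher (σ r) :=
    intervalIntegral.integral_nonneg hab fun r _ => K.fisher_nonneg _
  refine le_trans ?_ (add_le_add_left (mul_le_mul_right (K.ofReal_entropy_le (σ a)) 2⁻¹) _)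
  rw [hf, h2, h2, ← ENNReal.ofReal_mul hlam, ← ENNReal.ofReal_add
    (mul_nonneg (by norm_num) (K.entropy_nonneg _)) (mul_nonneg hlam hI)]
  exact (ENNReal.ofReal_le_ofReal h1).trans ENNReal.ofReal_add_le

/-- The entropy inequality for curves satisfying a Hamiltonian bound. -/
theorem HamiltonianBound.entropy_inequality (hV : 0 < V) {lam : ℝ} (hlam : 0 ≤ lam)
    {σ : ℝ → ProbabilityMeasure (Omega V)} {A : ℝ → ℝ} {a b : ℝ}
    (H : HamiltonianBound lam σ A a b) (hσ : ContinuousOn σ (Icc a b)) (hab : a ≤ b) :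
    2⁻¹ * Ent (σ b : Measure (Omega V)) (stat V) + ENNReal.ofReal lam * ∫⁻ r in Ioo a b, FI (σ r)
      ≤ 2⁻¹ * Ent (σ a : Measure (Omega V)) (stat V) + ENNReal.ofReal (A b - A a) := by
  by_cases htop : Ent (σ a : Measure (Omega V)) (stat V) = ∞
  · rw [htop, ENNReal.mul_top (by simp), top_add]
    exact le_top
  wlog hcont : Continuous σ generalizing σ
  · -- extend `σ` by constants outside of `[a, b]`
    have hc : Continuous fun r => σ (projIcc a b hab r) :=
      (continuousOn_iff_continuous_domRestrict.1 hσ).comp continuous_projIcc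
    have heq : EqOn (fun r => σ (projIcc a b hab r)) σ (Icc a b) := fun r hr => by
      simp only [projIcc_of_mem hab hr]
    have ha : σ (projIcc a b hab a) = σ a := heq (left_mem_Icc.2 hab)
    have hb : σ (projIcc a b hab b) = σ b := heq (right_mem_Icc.2 hab)
    have h1 := this (H.congr heq) hc.continuousOn (by rw [ha]; exact htop) hc
    rw [ha, hb, setLIntegral_congr_fun (g := fun r => FI (σ r)) measurableSet_Ioo
      (fun r hr => congrArg FI (heq (Ioo_subset_Icc_self hr)))] at h1
    exact h1
  obtain ⟨K, hK⟩ := exists_mollifier_seq hV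
  have hac : ∀ r ∈ Ioo a b, (σ r : Measure (Omega V)) ≪ stat V := fun r hr => by
    have h1 := mul_liminf_add_mul_liminf_le fun n =>
      (K n).ofReal_entropy_add_fisher_le hlam hcont hr.1.le (H.mono le_rfl hr.2.le)
    have h2 := (mul_le_mul_right (Mollifier.Ent_le_liminf hK (σ r)) 2⁻¹).trans
      (le_self_add.trans h1)
    have h3 : Ent (σ r : Measure (Omega V)) (stat V) ≠ ∞ := fun h => by
      rw [h, ENNReal.mul_top (by simp), top_le_iff] at h2
      exact ENNReal.add_ne_top.2 ⟨ENNReal.mul_ne_top (by simp) htop, ENNReal.ofReal_ne_top⟩ h2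
    exact (InformationTheory.klDiv_ne_top_iff.1 h3).1
  refine le_trans (add_le_add (mul_le_mul_right (Mollifier.Ent_le_liminf hK (σ b)) _)
    (mul_le_mul_right ?_ _)) (mul_liminf_add_mul_liminf_le fun n =>
      (K n).ofReal_entropy_add_fisher_le hlam hcont hab H)
  refine le_trans (setLIntegral_mono' measurableSet_Ioo fun r hr =>
    Mollifier.FI_le_liminf hK (σ r) (hac r hr)) (lintegral_liminf_le fun n => ?_)
  exact ((K n).continuous_fisher hcont).measurable.ennreal_ofReal

theorem HamiltonianBound.Ent_le (hV : 0 < V) {lam : ℝ} (hlam : 0 ≤ lam)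
    {σ : ℝ → ProbabilityMeasure (Omega V)} {A : ℝ → ℝ} {a b : ℝ}
    (H : HamiltonianBound lam σ A a b) (hσ : ContinuousOn σ (Icc a b)) (hab : a ≤ b)
    (hA : A b = A a) :
    Ent (σ b : Measure (Omega V)) (stat V) ≤ Ent (σ a : Measure (Omega V)) (stat V) := by
  have h := le_self_add.trans (H.entropy_inequality hV hlam hσ hab)
  rw [hA, sub_self, ENNReal.ofReal_zero, add_zero] at h
  exact (ENNReal.mul_le_mul_iff_right (by simp) (by simp)).1 h

end Kac

end

theorem theorem3p1 (V lam T : ℝ) (hV : 0 < V) (hlam : 0 < lam) (hT : 0 < T) :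
    (∀ (σ : ℝ → ProbabilityMeasure (Kac.Omega V)) (j : ℝ → Kac.Flux V),
      Kac.CE T σ j →
      Kac.Ent (σ 0 : Measure (Kac.Omega V)) (Kac.stat V) + Kac.rate lam T σ j < ∞ →
      ∀ t ∈ Icc 0 T,
        2⁻¹ * Kac.Ent (σ t : Measure (Kac.Omega V)) (Kac.stat V)
            + ENNReal.ofReal lam * ∫⁻ r in Ioo 0 t, Kac.FI (σ r)
          ≤ 2⁻¹ * Kac.Ent (σ 0 : Measure (Kac.Omega V)) (Kac.stat V) + Kac.rate lam T σ j) ∧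
    (∀ (σ₀ : ProbabilityMeasure (Kac.Omega V)) (σ : ℝ → ProbabilityMeasure (Kac.Omega V)),
      Kac.IsWeakSolution lam T σ₀ σ ∨ Kac.IsVariationalSolution lam T σ₀ σ →
      AntitoneOn (fun t => Kac.Ent (σ t : Measure (Kac.Omega V)) (Kac.stat V)) (Icc 0 T)) := by
  refine ⟨fun σ j hCE hfin t ht => ?_, fun σ₀ σ hσ s hs t ht hst => ?_⟩
  · have hrate : Kac.rate lam T σ j = ∫⁻ r in Ioo 0 T, Kac.lagrangian lam (σ r) (j r) := by
      rw [Kac.rate, if_pos hCE]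
    have hne := (ENNReal.add_lt_top.1 hfin).2.ne
    rw [hrate] at hne ⊢
    have h1 := ((hCE.hamiltonianBound hne).mono le_rfl ht.2).entropy_inequality hV hlam.le
      (hCE.continuousOn.mono (Icc_subset_Icc le_rfl ht.2)) ht.1
    refine h1.trans (add_le_add_right ?_ _)
    refine (ENNReal.ofReal_le_ofReal (sub_le_self _ ENNReal.toReal_nonneg)).trans ?_
    exact ENNReal.ofReal_toReal_le.trans (lintegral_mono_set (Ioo_subset_Ioo le_rfl ht.2))
  · rcases hσ with hw | ⟨j, hCE, h0⟩
    · exact ((hw.hamiltonianBound hlam.le).mono hs.1 ht.2).Ent_le hV hlam.le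
        (hw.continuousOn.mono (Icc_subset_Icc hs.1 ht.2)) hst rfl
    · have hrate : ∫⁻ r in Ioo 0 T, Kac.lagrangian lam (σ r) (j r) = 0 := by
        have h1 := (add_eq_zero.1 h0).2
        rwa [Kac.rate, if_pos hCE] at h1
      have hz : ∀ q ∈ Icc 0 T, ∫⁻ r in Ioo 0 q, Kac.lagrangian lam (σ r) (j r) = 0 := fun q hq =>
        le_antisymm (hrate ▸ lintegral_mono_set (Ioo_subset_Ioo le_rfl hq.2)) zero_le
      exact ((hCE.hamiltonianBound (by rw [hrate]; exact ENNReal.zero_ne_top)).mono hs.1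
        ht.2).Ent_le hV hlam.le (hCE.continuousOn.mono (Icc_subset_Icc hs.1 ht.2)) hst
        (by simp only [hz t ht, hz s hs])
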